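/- A sub-Riemannian manifold is a triple $(M,\mathcal D,g)$, where $M$ is a smooth finite-dimensional (Hausdorff, boundaryless) manifold, $\mathcal D\subset TM$ is a smooth distribution of constant rank and $g$ is a smoothly varying positive definite inner product on $\mathcal D$. A curve $\mu:[c,d]\to M$ is horizontal if it is absolutely continuous and $\dot\mu(t)\in\mathcal D_{\mu(t)}$ for almost every $t$; its length is $\ell(\mu)=\int_c^d g(\dot\mu,\dot\mu)^{1/2}\,dt$. For $q_0,q_1\in M$ let $\operatorname{dist}(q_0,q_1)\in[0,+\infty]$ be the infimum of the lengths of all horizontal curves joining $q_0$ and $q_1$ ($+\infty$ if there is none). A horizontal curve $\mu:[c,d]\to M$ is a length minimizer between two subsets $A,B\subset M$ if $\mu(c)\in A$, $\mu(d)\in B$ and $\ell(\mu)=\inf_{q_0\in A,\,q_1\in B}\operatorname{dist}(q_0,q_1)$. The sub-Riemannian Hamiltonian is $H:T^*M\to\mathbb R$, $H(p)=\tfrac12\,g^{-1}(p|_{\mathcal D},p|_{\mathcal D})$, where $g^{-1}$ is the inner product induced by $g$ on $\mathcal D^*$. A curve $\gamma:[a,b]\to M$ is a normal geodesic if it has a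 Hamiltonian lift, i.e. a curve $\Gamma:[a,b]\to T^*M$ over $\gamma$ that is an integral curve of the Hamiltonian vector field of $H$ with respect to the canonical symplectic form of $T^*M$ (in canonical coordinates: $\dot q=\partial H/\partial p$, $\dot p=-\partial H/\partial q$). **Proposition.** Let $(M,\mathcal D,g)$ be a sub-Riemannian manifold, $P\subset M$ a smooth embedded submanifold, $a<b$, and $\gamma:[a,b]\to M$ a normal geodesic with $\gamma(a)\in P$ which admits a Hamiltonian lift $\Gamma:[a,b]\to T^*M$ with $\Gamma(a)|_{T_{\gamma(a)}P}=0$. Then there is $\varepsilon_0>0$ with $a+\varepsilon_0\le b$ such that for every $\varepsilon\in(0,\varepsilon_0]$ the curve $\gamma|_{[a,a+\varepsilon]}$ is a length minimizer between $P$ and $\{\gamma(a+\varepsilon)\}$. -/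

import Mathlib

open Set MeasureTheory
open scoped Manifold ContDiff ENNReal

noncomputable section

namespace SubRiem

variable {E : Type*} [NormedAddCommGroup E] [NormedSpace ℝ E]
  {M : Type*} [TopologicalSpace M] [ChartedSpace E M]

/-- The cotangent space `T_x M^*` of a manifold `M` modelled on the normed space `E`. -/
abbrev CotangentSpace (E : Type*) [NormedAddCommGroup E] [NormedSpace ℝ E]
    {M : Type*} [TopologicalSpace M] [ChartedSpace E M] (x : M) : Type _ :=
  TangentSpace 𝓘(ℝ, E) x →L[ℝ] ℝ

/-- A vector field `X` on `M` is smooth on the set `U`. -/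
def SmoothVectorFieldOn [IsManifold 𝓘(ℝ, E) ∞ M] (X : ∀ x : M, TangentSpace 𝓘(ℝ, E) x) (U : Set M) : Prop :=
  ContMDiffOn 𝓘(ℝ, E) (𝓘(ℝ, E).prod 𝓘(ℝ, E)) ∞
    (fun x => (⟨x, X x⟩ : TangentBundle 𝓘(ℝ, E) M)) U

/-- A sub-Riemannian structure `(D, g)` on the manifold `M`: a smooth distribution `D` of constant
rank together with a smoothly varying positive definite inner product `g` on `D`. -/
structure SubRiemannianStructure (E : Type*) [NormedAddCommGroup E] [NormedSpace ℝ E]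
    (M : Type*) [TopologicalSpace M] [ChartedSpace E M] [IsManifold 𝓘(ℝ, E) ∞ M] where
  /-- the rank of the distribution -/
  rank : ℕ
  /-- the distribution -/
  D : ∀ x : M, Submodule ℝ (TangentSpace 𝓘(ℝ, E) x)
  /-- around every point, `D` is spanned by a smooth local frame of `rank` vector fields -/
  exists_frame : ∀ x₀ : M, ∃ U : Set M, IsOpen U ∧ x₀ ∈ U ∧
    ∃ X : Fin rank → ∀ x : M, TangentSpace 𝓘(ℝ, E) x,
      (∀ i, SmoothVectorFieldOn (X i) U) ∧
      ∀ x ∈ U, LinearIndependent ℝ (fun i => X i x) ∧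
        Submodule.span ℝ (Set.range fun i => X i x) = D x
  /-- the inner product on the fibres of `D` -/
  g : ∀ x : M, LinearMap.BilinForm ℝ (D x)
  g_symm : ∀ (x : M) (v w : D x), g x v w = g x w v
  g_pos : ∀ (x : M) (v : D x), v ≠ 0 → 0 < g x v v
  /-- `g X Y` is a smooth function for all smooth local sections `X`, `Y` of `D` -/
  g_smooth : ∀ U : Set M, IsOpen U → ∀ X Y : ∀ x : M, D x,
    SmoothVectorFieldOn (fun x => (X x : TangentSpace 𝓘(ℝ, E) x)) U →
    SmoothVectorFieldOn (fun x => (Y x : TangentSpace 𝓘(ℝ, E) x)) U →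
    ContMDiffOn 𝓘(ℝ, E) 𝓘(ℝ, ℝ) ∞ (fun x => g x (X x) (Y x)) U

/-- The differential at `x` of a chart `φ` of `M`. -/
def chartDifferential (φ : OpenPartialHomeomorph M E) (x : M) : TangentSpace 𝓘(ℝ, E) x →L[ℝ] E :=
  mfderiv 𝓘(ℝ, E) 𝓘(ℝ, E) φ x

/-- The canonical coordinates `(q, p)` of a covector `α ∈ T_x M^*` in the symplectic chart of
`T M^*` induced by the chart `φ` of `M`, for `x` in the domain of `φ`: `q = φ x` and
`p = α ∘ (dφ_x)⁻¹`. -/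
def cotangentCoord (φ : OpenPartialHomeomorph M E) (x : M) (α : CotangentSpace E x) :
    E × (E →L[ℝ] ℝ) :=
  (φ x, α.comp (chartDifferential φ x).inverse)

/-- A function `H` on `T M^*` written in the symplectic chart of `T M^*` induced by the chart `φ`
of `M`: the point with coordinates `(q, p)` is the covector `p ∘ dφ_x` at `x = φ⁻¹ q`. -/
def hamiltonianInChart (H : ∀ x : M, CotangentSpace E x → ℝ) (φ : OpenPartialHomeomorph M E)
    (z : E × (E →L[ℝ] ℝ)) : ℝ :=
  H (φ.symm z.1) (z.2.comp (chartDifferential φ (φ.symm z.1)))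

/-- The canonical symplectic form `ω = ∑ dqᵢ ∧ dpᵢ` in canonical coordinates, contracted with `u`:
`ω (u, w) = w_p u_q - u_p w_q`. -/
def symplecticContraction (u : E × (E →L[ℝ] ℝ)) : (E × (E →L[ℝ] ℝ)) →L[ℝ] ℝ :=
  (ContinuousLinearMap.apply ℝ ℝ u.1).comp (ContinuousLinearMap.snd ℝ E (E →L[ℝ] ℝ))
    - u.2.comp (ContinuousLinearMap.fst ℝ E (E →L[ℝ] ℝ))

/-- `Γ`, a curve of covectors along `γ : [a, b] → M`, is an integral curve of the Hamiltonian vector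
field of `H`: in every symplectic chart induced by a chart of `M`, it has a derivative `u` with
`dH = ω (u, ·)` at each time (one-sided derivatives at `a` and `b`). In coordinates these are the
Hamilton equations `q' = ∂H/∂p`, `p' = - ∂H/∂q`. -/
def IsHamiltonianSolution (H : ∀ x : M, CotangentSpace E x → ℝ) (γ : ℝ → M)
    (Γ : ∀ t : ℝ, CotangentSpace E (γ t)) (a b : ℝ) : Prop :=
  ContinuousOn γ (Icc a b) ∧
  ∀ φ ∈ IsManifold.maximalAtlas 𝓘(ℝ, E) ∞ M, ∀ t ∈ Icc a b, γ t ∈ φ.source →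
    ∃ u : E × (E →L[ℝ] ℝ),
      HasDerivWithinAt (fun s => cotangentCoord φ (γ s) (Γ s)) u (Icc a b) t ∧
      HasFDerivAt (hamiltonianInChart H φ) (symplecticContraction u)
        (cotangentCoord φ (γ t) (Γ t))

/-- The curve `γ : [a, b] → M` is absolutely continuous: it is continuous, and it is absolutely
continuous in every chart on every closed subinterval that it maps into the chart domain. -/
def IsAbsolutelyContinuousCurve (E : Type*) [NormedAddCommGroup E] [NormedSpace ℝ E]
    {M : Type*} [TopologicalSpace M] [ChartedSpace E M] (γ : ℝ → M) (a b : ℝ) : Prop :=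
  ContinuousOn γ (Icc a b) ∧
  ∀ φ ∈ IsManifold.maximalAtlas 𝓘(ℝ, E) ∞ M, ∀ c d : ℝ, a ≤ c → c ≤ d → d ≤ b →
    MapsTo γ (Icc c d) φ.source → AbsolutelyContinuousOnInterval (fun t => φ (γ t)) c d

/-- The velocity of the curve `γ : [a, b] → M` at time `t`. -/
def velocity (E : Type*) [NormedAddCommGroup E] [NormedSpace ℝ E]
    {M : Type*} [TopologicalSpace M] [ChartedSpace E M] (γ : ℝ → M) (a b t : ℝ) :
    TangentSpace 𝓘(ℝ, E) (γ t) :=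
  mfderivWithin 𝓘(ℝ, ℝ) 𝓘(ℝ, E) γ (Icc a b) t (1 : ℝ)

instance instFiniteDimensionalTangentSpace [FiniteDimensional ℝ E] (x : M) : FiniteDimensional ℝ (TangentSpace 𝓘(ℝ, E) x) :=
  inferInstanceAs (FiniteDimensional ℝ E)

namespace SubRiemannianStructure

variable [IsManifold 𝓘(ℝ, E) ∞ M] (S : SubRiemannianStructure E M)

theorem g_nondegenerate (x : M) : (S.g x).Nondegenerate := by
  constructor
  · intro v hv
    by_contra h
    exact (S.g_pos x v h).ne' (hv v)
  · intro v hv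
    by_contra h
    exact (S.g_pos x v h).ne' (hv v)

/-- The vector of `D_x` that represents the linear functional `l ∈ D_x^*` with respect to `g`. -/
def sharp [FiniteDimensional ℝ E] (x : M) (l : Module.Dual ℝ (S.D x)) : S.D x :=
  ((S.g x).toDual (S.g_nondegenerate x)).symm l

/-- The inner product `g⁻¹` on `D_x^*` induced by `g`. -/
def gInv [FiniteDimensional ℝ E] (x : M) (l m : Module.Dual ℝ (S.D x)) : ℝ :=
  S.g x (S.sharp x l) (S.sharp x m)

/-- The sub-Riemannian Hamiltonian `H(p) = 1/2 g⁻¹(p|_D, p|_D)` on `T M^*`. -/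
def hamiltonian [FiniteDimensional ℝ E] (x : M) (p : CotangentSpace E x) : ℝ :=
  1 / 2 * S.gInv x (p.toLinearMap.domRestrict (S.D x)) (p.toLinearMap.domRestrict (S.D x))

/-- `Γ` is a Hamiltonian lift of `γ : [a, b] → M`: a curve in `T M^*` over `γ` that is a solution
of the sub-Riemannian Hamiltonian. -/
def IsHamiltonianLift [FiniteDimensional ℝ E] (γ : ℝ → M) (Γ : ∀ t : ℝ, CotangentSpace E (γ t))
    (a b : ℝ) : Prop :=
  IsHamiltonianSolution (S.hamiltonian) γ Γ a b

/-- `γ : [a, b] → M` is a normal geodesic: it admits a Hamiltonian lift. -/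
def IsNormalGeodesic [FiniteDimensional ℝ E] (γ : ℝ → M) (a b : ℝ) : Prop :=
  ∃ Γ : ∀ t : ℝ, CotangentSpace E (γ t), S.IsHamiltonianLift γ Γ a b

/-- `γ : [a, b] → M` is horizontal: it is absolutely continuous and its velocity lies in `D` almost
everywhere. -/
def IsHorizontal (γ : ℝ → M) (a b : ℝ) : Prop :=
  IsAbsolutelyContinuousCurve E γ a b ∧
  ∀ᵐ t ∂(volume.restrict (Icc a b)), velocity E γ a b t ∈ S.D (γ t)

open Classical in
/-- The norm `g(v, v)^(1/2)` of a horizontal vector `v` (and `∞` for a vector outside `D`). -/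
def enorm (x : M) (v : TangentSpace 𝓘(ℝ, E) x) : ℝ≥0∞ :=
  if h : v ∈ S.D x then ENNReal.ofReal (Real.sqrt (S.g x ⟨v, h⟩ ⟨v, h⟩)) else ⊤

/-- The length `∫_a^b g(γ', γ')^(1/2) dt` of a horizontal curve `γ : [a, b] → M`. -/
def length (γ : ℝ → M) (a b : ℝ) : ℝ≥0∞ :=
  ∫⁻ t in Icc a b, S.enorm (γ t) (velocity E γ a b t)

/-- The sub-Riemannian distance: the infimum of the lengths of the horizontal curves joining `q₀`
and `q₁`, which is `∞` if there is no such curve. -/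
def dist (q₀ q₁ : M) : ℝ≥0∞ :=
  sInf {l | ∃ (μ : ℝ → M) (c d : ℝ), c < d ∧ S.IsHorizontal μ c d ∧ μ c = q₀ ∧ μ d = q₁ ∧
    S.length μ c d = l}

/-- The curve `γ : [a, b] → M` is length minimizing between the subsets `P` and `Q` of `M`. -/
def IsLengthMinimizing (γ : ℝ → M) (a b : ℝ) (P Q : Set M) : Prop :=
  S.IsHorizontal γ a b ∧ γ a ∈ P ∧ γ b ∈ Q ∧
    S.length γ a b = ⨅ q₀ ∈ P, ⨅ q₁ ∈ Q, S.dist q₀ q₁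

end SubRiemannianStructure

end SubRiem

end

/-!
The proof is a calibration in time-dependent form. It needs neither a solution of the
Hamilton–Jacobi equation nor the smooth dependence of the Hamiltonian flow on its initial data.

Since `P` is the image of an embedding, there is a chart around `γ a` in which `P` is a linear slice
(`exists_chart_annihilating`), so that the initial covector `p(a)` vanishes on the displacements
within `P`. In this chart let `(q, p)` be the Hamiltonian curve, let `v² / 2` be its (constant)
energy, and let `Q` be a Euclidean form on the model space. The barrier
`F (t, y) = v² (t - a) / 2 + p(t) (y - q(t)) - K (t - a) Q(y - q(t), y - q(t))`
is a subsolution of the Hamilton–Jacobi equation, `∂F/∂t + H(y, ∂F/∂y) ≤ 0`, near `γ a` and for short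
time, if `K` is large: by the Hamilton equations the terms of order at most one in `y - q(t)`
cancel, and the second-order Taylor remainder of `H` is absorbed by `- K Q`
(`exists_barrier_subsolution`). Here `H` has to be `C²`, which follows from its expression through
the Gram matrix of a local frame (`SubRiemannianStructure.contDiffAt_hamiltonianInChart`).

Let `y` be a curve of speed `m` from `P` to `γ (a + ε)` inside the chart, of length less than
`v ε`. With the time change `τ' = m / v + κ`, where `κ > 0` is chosen so that `τ` runs from `a` to
`a + ε`, the Fenchel–Young inequality gives `d/ds F (τ s, y s) ≤ m² / (2 τ') ≤ v m / 2`. Integration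
yields `v² ε / 2 ≤ v / 2 * length`, because `F ≤ 0` on `P` at time `a`; this is a contradiction
(`ofReal_le_lintegral_of_barrier`). Curves that leave the chart are too long
(`SubRiemannianStructure.mapsTo_or_ofReal_le_length`), and `γ` itself has length `v ε`
(`SubRiemannianStructure.IsHamiltonianLift.length_eq`).
-/

namespace SubRiem

/-! ### Absolutely continuous functions -/

/-- A function whose increments are controlled by those of two absolutely continuous functions is
absolutely continuous. -/
theorem absolutelyContinuousOnInterval_of_dist_le {X Y Z : Type*} [PseudoMetricSpace X]
    [PseudoMetricSpace Y] [PseudoMetricSpace Z] {f : ℝ → X} {g : ℝ → Y} {h : ℝ → Z} {a b C : ℝ}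
    (hf : AbsolutelyContinuousOnInterval f a b) (hg : AbsolutelyContinuousOnInterval g a b)
    (hC : ∀ x ∈ uIcc a b, ∀ y ∈ uIcc a b,
      dist (h x) (h y) ≤ C * (dist (f x) (f y) + dist (g x) (g y))) :
    AbsolutelyContinuousOnInterval h a b := by
  unfold AbsolutelyContinuousOnInterval at hf hg ⊢
  have hlim := (hf.add hg).const_mul C
  rw [add_zero, mul_zero] at hlim
  refine squeeze_zero' (Filter.Eventually.of_forall fun I ↦
    Finset.sum_nonneg fun _ _ ↦ dist_nonneg) ?_ hlim
  filter_upwards [Filter.mem_inf_of_right (Filter.mem_principal_self _)] with I hI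
  rw [← Finset.sum_add_distrib, Finset.mul_sum]
  exact Finset.sum_le_sum fun i hi ↦ hC _ (hI.1 i hi).1 _ (hI.1 i hi).2

theorem _root_.LipschitzOnWith.comp_absolutelyContinuousOnInterval {X Y : Type*}
    [PseudoMetricSpace X] [PseudoMetricSpace Y] {f : ℝ → X} {g : X → Y} {s : Set X} {K : NNReal}
    {a b : ℝ} (hg : LipschitzOnWith K g s) (hf : AbsolutelyContinuousOnInterval f a b)
    (hs : MapsTo f (uIcc a b) s) : AbsolutelyContinuousOnInterval (fun t ↦ g (f t)) a b := by
  refine absolutelyContinuousOnInterval_of_dist_le (C := K) hf hf fun x hx y hy ↦ ?_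
  refine (hg.dist_le_mul _ (hs hx) _ (hs hy)).trans ?_
  gcongr
  linarith [dist_nonneg (x := f x) (y := f y)]

theorem _root_.ContinuousLinearMap.comp_absolutelyContinuousOnInterval {V W : Type*}
    [NormedAddCommGroup V] [NormedSpace ℝ V] [NormedAddCommGroup W] [NormedSpace ℝ W]
    (L : V →L[ℝ] W) {f : ℝ → V} {a b : ℝ} (hf : AbsolutelyContinuousOnInterval f a b) :
    AbsolutelyContinuousOnInterval (fun t ↦ L (f t)) a b :=
  (L.lipschitz.lipschitzOnWith (s := univ)).comp_absolutelyContinuousOnInterval hf (mapsTo_univ _ _)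

theorem _root_.ContinuousLinearMap.absolutelyContinuousOnInterval_bilinear {V W Z : Type*}
    [NormedAddCommGroup V] [NormedSpace ℝ V] [NormedAddCommGroup W] [NormedSpace ℝ W]
    [NormedAddCommGroup Z] [NormedSpace ℝ Z] (B : V →L[ℝ] W →L[ℝ] Z) {f : ℝ → V} {g : ℝ → W}
    {a b : ℝ} (hf : AbsolutelyContinuousOnInterval f a b)
    (hg : AbsolutelyContinuousOnInterval g a b) :
    AbsolutelyContinuousOnInterval (fun t ↦ B (f t) (g t)) a b := by
  obtain ⟨Cf, hCf⟩ := hf.exists_bound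
  obtain ⟨Cg, hCg⟩ := hg.exists_bound
  have hCf0 : 0 ≤ Cf := (norm_nonneg _).trans (hCf a left_mem_uIcc)
  have hCg0 : 0 ≤ Cg := (norm_nonneg _).trans (hCg a left_mem_uIcc)
  refine absolutelyContinuousOnInterval_of_dist_le (C := ‖B‖ * (Cf + Cg)) hf hg fun x hx y hy ↦ ?_
  have e : B (f x) (g x) - B (f y) (g y) = B (f x - f y) (g x) + B (f y) (g x - g y) := by
    simp
  rw [dist_eq_norm, dist_eq_norm, dist_eq_norm, e]
  have h1 := B.le_opNorm₂ (f x - f y) (g x)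
  have h2 := B.le_opNorm₂ (f y) (g x - g y)
  calc _ ≤ ‖B‖ * ‖f x - f y‖ * ‖g x‖ + ‖B‖ * ‖f y‖ * ‖g x - g y‖ :=
        (norm_add_le _ _).trans (add_le_add h1 h2)
    _ ≤ ‖B‖ * ‖f x - f y‖ * (Cf + Cg) + ‖B‖ * (Cf + Cg) * ‖g x - g y‖ := by
        gcongr
        · linarith [hCg x hx]
        · linarith [hCf y hy]
    _ = _ := by ring

/-- The increment of an absolutely continuous function is at most the integral of any upper bound
of its derivative. No measurability of the bound is needed. -/
theorem _root_.AbsolutelyContinuousOnInterval.ofReal_sub_le_lintegral {h : ℝ → ℝ} {c d : ℝ}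
    (hcd : c ≤ d) (hh : AbsolutelyContinuousOnInterval h c d) {m : ℝ → ℝ≥0∞}
    (hm : ∀ᵐ t, t ∈ Ioo c d → ENNReal.ofReal (deriv h t) ≤ m t) :
    ENNReal.ofReal (h d - h c) ≤ ∫⁻ t in Icc c d, m t := by
  have hint := hh.intervalIntegrable_deriv
  rw [intervalIntegrable_iff_integrableOn_Ioc_of_le hcd] at hint
  rw [← hh.integral_deriv_eq_sub, intervalIntegral.integral_of_le hcd]
  calc ENNReal.ofReal (∫ t in Ioc c d, deriv h t)
      ≤ ENNReal.ofReal (∫ t in Ioc c d, max (deriv h t) 0) := by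
        refine ENNReal.ofReal_le_ofReal (integral_mono hint hint.pos_part fun t ↦ le_max_left _ _)
    _ = ∫⁻ t in Ioc c d, ENNReal.ofReal (max (deriv h t) 0) :=
        ofReal_integral_eq_lintegral_ofReal hint.pos_part
          (Filter.Eventually.of_forall fun t ↦ le_max_right _ _)
    _ = ∫⁻ t in Icc c d, ENNReal.ofReal (deriv h t) := by
        rw [setLIntegral_congr Ioc_ae_eq_Icc]
        simp
    _ = ∫⁻ t in Ioo c d, ENNReal.ofReal (deriv h t) := setLIntegral_congr Ioo_ae_eq_Icc.symm
    _ ≤ ∫⁻ t in Ioo c d, m t := by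
        exact lintegral_mono_ae ((ae_restrict_iff' measurableSet_Ioo).2 hm)
    _ ≤ _ := lintegral_mono_set Ioo_subset_Icc_self

end SubRiem

namespace SubRiem

/-! ### A barrier for the Hamilton–Jacobi equation -/

/-- Second-order Taylor estimate, uniform in the base point, for a function that is `C²` at `z₀`. -/
theorem exists_taylor_bound_of_contDiffAt_two {V : Type*} [NormedAddCommGroup V] [NormedSpace ℝ V]
    {f : V → ℝ} {z₀ : V} (hf : ContDiffAt ℝ 2 f z₀) :
    ∃ C : ℝ, 0 ≤ C ∧ ∃ r : ℝ, 0 < r ∧ ∀ z ∈ Metric.ball z₀ r, ∀ w ∈ Metric.ball z₀ r,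
      f w ≤ f z + fderiv ℝ f z (w - z) + C * ‖w - z‖ ^ 2 := by
  obtain ⟨K, s, hs, hK⟩ := (hf.fderiv_right (m := 1) (by norm_num)).exists_lipschitzOnWith
  have hdiff : ∀ᶠ z in nhds z₀, DifferentiableAt ℝ f z :=
    (hf.eventually (by simp)).mono fun z hz ↦ hz.differentiableAt (by simp)
  obtain ⟨r, hr, hball⟩ := Metric.mem_nhds_iff.1 (Filter.inter_mem hs hdiff)
  refine ⟨K, K.2, r, hr, fun z hz w hw ↦ ?_⟩
  have hseg : segment ℝ z w ⊆ Metric.ball z₀ r := (convex_ball z₀ r).segment_subset hz hw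
  have key := (convex_segment z w).norm_image_sub_le_of_norm_hasFDerivWithin_le'
    (f := f) (f' := fderiv ℝ f) (φ := fderiv ℝ f z) (C := K * ‖w - z‖)
    (fun x hx ↦ (hball (hseg hx)).2.hasFDerivAt.hasFDerivWithinAt)
    (fun x hx ↦ by
      rw [← dist_eq_norm]
      refine (hK.dist_le_mul _ (hball (hseg hx)).1 _ (hball hz).1).trans ?_
      gcongr
      obtain ⟨θ, hθ, rfl⟩ := (segment_eq_image' ℝ z w) ▸ hx
      rw [dist_eq_norm, add_sub_cancel_left, norm_smul, Real.norm_eq_abs, abs_of_nonneg hθ.1]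
      exact mul_le_of_le_one_left (norm_nonneg _) hθ.2)
    (left_mem_segment ℝ z w) (right_mem_segment ℝ z w)
  have := (le_abs_self _).trans key
  nlinarith

variable {E : Type*} [NormedAddCommGroup E] [NormedSpace ℝ E]

section barrier

variable (Q : E →L[ℝ] E →L[ℝ] ℝ) (v a K : ℝ) (q : ℝ → E) (p : ℝ → E →L[ℝ] ℝ)

/-- The barrier `F (t, y) = v² (t - a) / 2 + p(t) (y - q(t)) - K (t - a) Q(y - q(t), y - q(t))`
around the curve `q` with momentum `p`. Its differential in `y` along the curve is `p`. -/
noncomputable def barrier (t : ℝ) (y : E) : ℝ :=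
  v ^ 2 / 2 * (t - a) + p t (y - q t) - K * (t - a) * Q (y - q t) (y - q t)

/-- The differential of the barrier in the space variable. -/
noncomputable def barrierCovector (t : ℝ) (y : E) : E →L[ℝ] ℝ :=
  p t - (2 * K * (t - a)) • Q (y - q t)

/-- The time derivative of the barrier, when `(q, p)` has the derivative `u` at time `t`. -/
noncomputable def barrierTimeDeriv (u : E × (E →L[ℝ] ℝ)) (t : ℝ) (y : E) : ℝ :=
  v ^ 2 / 2 + u.2 (y - q t) - p t u.1 - K * Q (y - q t) (y - q t)
    + 2 * K * (t - a) * Q (y - q t) u.1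

variable {Q v a K q p}

/-- The chain rule for the barrier along a curve `s ↦ (τ s, y s)`. -/
theorem hasDerivAt_barrier_comp (hQ : ∀ x y, Q x y = Q y x) {τ : ℝ → ℝ} {y : ℝ → E} {s τ' : ℝ}
    {w : E} {u : E × (E →L[ℝ] ℝ)} (hτ : HasDerivAt τ τ' s) (hy : HasDerivAt y w s)
    (hz : HasDerivAt (fun t ↦ (q t, p t)) u (τ s)) :
    HasDerivAt (fun s ↦ barrier Q v a K q p (τ s) (y s))
      (τ' * barrierTimeDeriv Q v a K q p u (τ s) (y s)
        + barrierCovector Q a K q p (τ s) (y s) w) s := by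
  have hq : HasDerivAt (fun s ↦ q (τ s)) (τ' • u.1) s := by
    have h1 : HasDerivAt q u.1 (τ s) := hz.fst
    exact h1.scomp s hτ
  have hp : HasDerivAt (fun s ↦ p (τ s)) (τ' • u.2) s := by
    have h1 : HasDerivAt p u.2 (τ s) := hz.snd
    exact h1.scomp s hτ
  have hx := hy.sub hq
  have hQx : HasDerivAt (fun s ↦ Q (y s - q (τ s))) (Q (w - τ' • u.1)) s :=
    Q.hasFDerivAt.comp_hasDerivAt s hx
  have h1 := ((hτ.sub_const a).const_mul (v ^ 2 / 2)).add (hp.clm_apply hx)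
  have h2 := h1.sub (((hτ.sub_const a).const_mul K).mul (hQx.clm_apply hx))
  refine (h2.congr_deriv ?_).congr_of_eventuallyEq (Filter.Eventually.of_forall fun s ↦ ?_)
  · simp only [barrierTimeDeriv, barrierCovector, Pi.sub_apply, map_sub, map_smul,
      _root_.sub_apply, _root_.smul_apply, smul_eq_mul]
    rw [hQ w, hQ u.1, hQ w, hQ u.1]
    ring
  · simp [barrier]

theorem absolutelyContinuousOnInterval_barrier_comp {τ : ℝ → ℝ} {y : ℝ → E} {c d : ℝ}
    {A : Set ℝ} {Kq Kp : NNReal} (hq : LipschitzOnWith Kq q A) (hp : LipschitzOnWith Kp p A)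
    (hτ : AbsolutelyContinuousOnInterval τ c d) (hτA : MapsTo τ (uIcc c d) A)
    (hy : AbsolutelyContinuousOnInterval y c d) :
    AbsolutelyContinuousOnInterval (fun s ↦ barrier Q v a K q p (τ s) (y s)) c d := by
  have hx := hy.sub (hq.comp_absolutelyContinuousOnInterval hτ hτA)
  have hτa : AbsolutelyContinuousOnInterval (fun s ↦ τ s - a) c d :=
    (LipschitzWith.id.sub (LipschitzWith.const a)).lipschitzOnWith (s := univ)
      |>.comp_absolutelyContinuousOnInterval hτ (mapsTo_univ _ _)
  have hpx := (ContinuousLinearMap.id ℝ (E →L[ℝ] ℝ)).absolutelyContinuousOnInterval_bilinear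
    (hp.comp_absolutelyContinuousOnInterval hτ hτA) hx
  have hQx := Q.absolutelyContinuousOnInterval_bilinear hx hx
  exact ((hτa.const_mul (v ^ 2 / 2)).add hpx).sub ((hτa.const_mul K).mul hQx)

/-- Along a Hamiltonian curve of energy `v² / 2`, the barrier is a subsolution of the
Hamilton–Jacobi equation for short time if `K` is large: the terms of order zero and one in
`y - q(t)` cancel by the Hamilton equations, and the Taylor remainder of `H` is absorbed by
`- K Q`. -/
theorem exists_barrier_subsolution {H : E × (E →L[ℝ] ℝ) → ℝ} {u : ℝ → E × (E →L[ℝ] ℝ)} {b c : ℝ}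
    (hab : a < b) (hc : 0 < c) (hQc : ∀ x, c * ‖x‖ ^ 2 ≤ Q x x)
    (hcont : ContinuousOn (fun t ↦ (q t, p t)) (Icc a b))
    (hH : ∀ t ∈ Icc a b, HasFDerivAt H (symplecticContraction (u t)) (q t, p t))
    (hv : ∀ t ∈ Icc a b, H (q t, p t) = v ^ 2 / 2) (hpu : ∀ t ∈ Icc a b, p t (u t).1 = v ^ 2)
    (hC2 : ContDiffAt ℝ 2 H (q a, p a)) :
    ∃ K : ℝ, ∃ δ > 0, a + δ ≤ b ∧ ∃ r > 0, ∀ t ∈ Icc a (a + δ), ∀ y ∈ Metric.ball (q a) r,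
      barrierTimeDeriv Q v a K q p (u t) t y + H (y, barrierCovector Q a K q p t y) ≤ 0 := by
  obtain ⟨C, hC, r, hr, htaylor⟩ := exists_taylor_bound_of_contDiffAt_two hC2
  have hnear := hcont a (left_mem_Icc.2 hab.le)
  obtain ⟨δ₁, hδ₁, hδ₁r⟩ := Metric.continuousWithinAt_iff.1 hnear (r / 4) (by positivity)
  set K : ℝ := C / c with hK
  have hK0 : 0 ≤ K := by positivity
  set δ₂ : ℝ := 1 / (2 * K * ‖Q‖ + 1) with hδ₂
  have hden : 0 < 2 * K * ‖Q‖ + 1 := by positivity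
  refine ⟨K, min (min (δ₁ / 2) δ₂) (b - a), ?_, ?_, r / 4, by positivity, fun t ht y hy ↦ ?_⟩
  · have : 0 < b - a := by linarith
    positivity
  · linarith [min_le_right (min (δ₁ / 2) δ₂) (b - a)]
  have hm1 := min_le_left (min (δ₁ / 2) δ₂) (b - a)
  have hm2 := min_le_right (min (δ₁ / 2) δ₂) (b - a)
  have hm3 := min_le_left (δ₁ / 2) δ₂
  have hm4 := min_le_right (δ₁ / 2) δ₂
  have htab : t ∈ Icc a b := ⟨ht.1, by linarith [ht.2]⟩
  have hzt : dist (q t, p t) (q a, p a) < r / 4 := hδ₁r htab (by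
    rw [Real.dist_eq, abs_of_nonneg (by linarith [ht.1])]; linarith [ht.2])
  set x : E := y - q t with hx
  have hqt : dist (q t) (q a) < r / 4 := (le_max_left _ _).trans_lt hzt
  have hxr : ‖x‖ < r / 2 := by
    rw [hx, ← dist_eq_norm]
    have := dist_triangle_right y (q t) (q a)
    rw [Metric.mem_ball] at hy
    linarith
  -- the displacement from `(q t, p t)` to `(y, dF)` has norm at most `‖x‖`
  have hsmall : ‖((y, barrierCovector Q a K q p t y) : E × (E →L[ℝ] ℝ)) - (q t, p t)‖ ≤ ‖x‖ := by
    have hs : (2 * K * (t - a)) * ‖Q‖ ≤ 1 := by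
      have h1 : t - a ≤ 1 / (2 * K * ‖Q‖ + 1) := by linarith [ht.2]
      rw [le_div_iff₀ hden] at h1
      nlinarith [ht.1]
    simp only [barrierCovector, Prod.mk_sub_mk, sub_sub_cancel_left, Prod.norm_mk, norm_neg]
    refine max_le le_rfl ?_
    rw [norm_smul, Real.norm_of_nonneg (mul_nonneg (by positivity) (by linarith [ht.1]))]
    calc (2 * K * (t - a)) * ‖Q x‖ ≤ (2 * K * (t - a)) * (‖Q‖ * ‖x‖) := by
          gcongr
          · exact mul_nonneg (by positivity) (by linarith [ht.1])
          · exact Q.le_opNorm x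
      _ = ((2 * K * (t - a)) * ‖Q‖) * ‖x‖ := by ring
      _ ≤ ‖x‖ := mul_le_of_le_one_left (norm_nonneg _) hs
  have hw : ((y, barrierCovector Q a K q p t y) : E × (E →L[ℝ] ℝ)) ∈ Metric.ball (q a, p a) r := by
    rw [Metric.mem_ball]
    have := dist_triangle (y, barrierCovector Q a K q p t y) (q t, p t) (q a, p a)
    rw [dist_eq_norm _ (q t, p t)] at this
    linarith
  have key := htaylor (q t, p t) (by rw [Metric.mem_ball]; linarith) _ hw
  rw [(hH t htab).fderiv, hv t htab] at key
  have hsq : C * ‖((y, barrierCovector Q a K q p t y) : E × (E →L[ℝ] ℝ)) - (q t, p t)‖ ^ 2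
      ≤ K * Q x x := by
    calc _ ≤ C * ‖x‖ ^ 2 := by gcongr
      _ = K * (c * ‖x‖ ^ 2) := by rw [hK]; field_simp
      _ ≤ _ := by gcongr; exact hQc x
  have hlin : symplecticContraction (u t)
      (((y, barrierCovector Q a K q p t y) : E × (E →L[ℝ] ℝ)) - (q t, p t))
      = - (2 * K * (t - a)) * Q x (u t).1 - (u t).2 x := by
    simp [symplecticContraction, barrierCovector, hx]
  rw [hlin] at key
  have hb : barrierTimeDeriv Q v a K q p (u t) t y
      = v ^ 2 / 2 + (u t).2 x - v ^ 2 - K * Q x x + 2 * K * (t - a) * Q x (u t).1 := by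
    rw [barrierTimeDeriv, hpu t htab]
  rw [hb]
  linarith

end barrier

/-- A finite-dimensional real normed space carries a Euclidean inner product. -/
theorem exists_euclidean_form (E : Type*) [NormedAddCommGroup E] [NormedSpace ℝ E]
    [FiniteDimensional ℝ E] : ∃ Q : E →L[ℝ] E →L[ℝ] ℝ, (∀ x y, Q x y = Q y x) ∧
      ∃ c > 0, ∀ x, c * ‖x‖ ^ 2 ≤ Q x x := by
  let T : E ≃L[ℝ] EuclideanSpace ℝ (Fin (Module.finrank ℝ E)) := toEuclidean
  let C := ‖(T.symm : EuclideanSpace ℝ (Fin (Module.finrank ℝ E)) →L[ℝ] E)‖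
  refine ⟨(innerSL ℝ).bilinearComp T.toContinuousLinearMap T.toContinuousLinearMap, fun x y ↦ ?_,
    1 / (C ^ 2 + 1), by positivity, fun x ↦ ?_⟩
  · simp [real_inner_comm]
  · have h1 : ‖x‖ ≤ C * ‖T x‖ := by
      simpa using (T.symm : EuclideanSpace ℝ (Fin (Module.finrank ℝ E)) →L[ℝ] E).le_opNorm (T x)
    have h2 : ‖x‖ ^ 2 ≤ (C * ‖T x‖) ^ 2 := by gcongr
    simp only [ContinuousLinearMap.bilinearComp_apply, innerSL_apply_apply,
      ContinuousLinearEquiv.coe_coe, real_inner_self_eq_norm_sq]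
    rw [div_mul_eq_mul_div, one_mul, div_le_iff₀ (by positivity)]
    nlinarith [sq_nonneg ‖T x‖]

end SubRiem

namespace SubRiem

variable {E : Type*} [NormedAddCommGroup E] [NormedSpace ℝ E]

/-! ### The length of curves in a chart -/

/-- The function `m` bounds the speed of the curve `y`, measured with the dual of the Hamiltonian
`H`: this is the Fenchel–Young inequality `p(y') ≤ H(y, p) + m² / 2`. -/
def SpeedLE (H : E × (E →L[ℝ] ℝ) → ℝ) (y : ℝ → E) (m : ℝ → ℝ≥0∞) (t : ℝ) : Prop :=
  ∀ p : E →L[ℝ] ℝ, ENNReal.ofReal (2 * (p (deriv y t) - H (y t, p))) ≤ m t ^ 2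

/-- Any bound of the speed dominates a measurable one, namely the dual norm of the velocity. -/
theorem exists_aemeasurable_speedLE [FiniteDimensional ℝ E] {H : E × (E →L[ℝ] ℝ) → ℝ} {U : Set E}
    (hH : ContinuousOn H (U ×ˢ univ)) {y : ℝ → E} {c d : ℝ} (hy : ContinuousOn y (Icc c d))
    (hyU : MapsTo y (Icc c d) U) {m : ℝ → ℝ≥0∞} (hm : ∀ᵐ t, t ∈ Ioo c d → SpeedLE H y m t) :
    ∃ m' : ℝ → ℝ≥0∞, AEMeasurable m' (volume.restrict (Icc c d)) ∧
      (∀ᵐ t, t ∈ Ioo c d → m' t ≤ m t) ∧ ∀ t ∈ Icc c d, SpeedLE H y m' t := by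
  have : ProperSpace (E →L[ℝ] ℝ) := FiniteDimensional.proper ℝ _
  let P : ℕ → E →L[ℝ] ℝ := TopologicalSpace.denseSeq _
  let s : ℝ → ℝ≥0∞ := fun t ↦ ⨆ n, ENNReal.ofReal (2 * (P n (deriv y t) - H (y t, P n)))
  have hsq : ∀ t, (s t ^ (1 / 2 : ℝ)) ^ 2 = s t := fun t ↦ by
    rw [← ENNReal.rpow_natCast, ← ENNReal.rpow_mul]; norm_num
  refine ⟨fun t ↦ s t ^ (1 / 2 : ℝ), ?_, ?_, fun t ht p ↦ ?_⟩
  · refine AEMeasurable.pow_const (AEMeasurable.iSup fun n ↦ ?_) _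
    borelize E
    have h1 : Measurable fun t ↦ P n (deriv y t) := (P n).measurable.comp (measurable_deriv y)
    have h2 : ContinuousOn (fun t ↦ H (y t, P n)) (Icc c d) :=
      hH.comp (hy.prodMk continuousOn_const) fun t ht ↦ ⟨hyU ht, mem_univ _⟩
    exact ((h1.aemeasurable.sub (h2.aemeasurable measurableSet_Icc)).const_mul 2).ennreal_ofReal
  · filter_upwards [hm] with t ht htI
    have : s t ≤ m t ^ 2 := iSup_le fun n ↦ ht htI (P n)
    calc s t ^ (1 / 2 : ℝ) ≤ (m t ^ 2) ^ (1 / 2 : ℝ) := ENNReal.rpow_le_rpow this (by norm_num)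
      _ = m t := by rw [← ENNReal.rpow_natCast, ← ENNReal.rpow_mul]; norm_num
  · rw [hsq]
    have hcont : Continuous fun p : E →L[ℝ] ℝ ↦
        ENNReal.ofReal (2 * (p (deriv y t) - H (y t, p))) := by
      have h1 : Continuous fun p : E →L[ℝ] ℝ ↦ H (y t, p) := by
        rw [← continuousOn_univ]
        exact hH.comp (continuousOn_const.prodMk continuousOn_id) fun p _ ↦ ⟨hyU ht, mem_univ _⟩
      have h2 : Continuous fun p : E →L[ℝ] ℝ ↦ p (deriv y t) :=
        (ContinuousLinearMap.apply ℝ ℝ (deriv y t)).continuous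
      exact ENNReal.continuous_ofReal.comp ((h2.sub h1).const_mul 2)
    have hclosed : IsClosed {p : E →L[ℝ] ℝ |
        ENNReal.ofReal (2 * (p (deriv y t) - H (y t, p))) ≤ s t} :=
      isClosed_le hcont continuous_const
    have hsub := hclosed.closure_subset_iff.2 (range_subset_iff.2 fun n ↦
      le_iSup (fun n ↦ ENNReal.ofReal (2 * (P n (deriv y t) - H (y t, P n)))) n)
    rw [(TopologicalSpace.denseRange_denseSeq (E →L[ℝ] ℝ)).closure_range] at hsub
    exact hsub (mem_univ p)

/-- The pairing of a covector with the velocity is bounded by the energy of the covector and the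
speed, with an arbitrary weight. -/
theorem SpeedLE.apply_le {H : E × (E →L[ℝ] ℝ) → ℝ} {y : ℝ → E} {m : ℝ → ℝ≥0∞} {t : ℝ}
    (h : SpeedLE H y m t) (hhom : ∀ (l : ℝ) (p : E →L[ℝ] ℝ), H (y t, l • p) = l ^ 2 * H (y t, p))
    (hm : m t ≠ ⊤) (p : E →L[ℝ] ℝ) {l : ℝ} (hl : 0 < l) :
    p (deriv y t) ≤ l * H (y t, p) + (m t).toReal ^ 2 / (2 * l) := by
  have h1 := h (l • p)
  rw [hhom, ← ENNReal.ofReal_toReal (ENNReal.pow_ne_top hm), ENNReal.toReal_pow,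
    ENNReal.ofReal_le_ofReal_iff (by positivity)] at h1
  simp only [_root_.smul_apply, smul_eq_mul] at h1
  rw [← sub_le_iff_le_add', le_div_iff₀ (by positivity)]
  linarith

/-- The calibration inequality. Time is reparametrized by `τ' = m / v + κ`, which makes a curve that
is shorter than `v ε` arrive at time `a + ε`; along `s ↦ (τ s, y s)` the derivative of the barrier
is then at most `v m / 2`. -/
theorem ofReal_le_lintegral_of_barrier [FiniteDimensional ℝ E] {H : E × (E →L[ℝ] ℝ) → ℝ}
    {U : Set E} (hH : ContinuousOn H (U ×ˢ univ))
    (hhom : ∀ y ∈ U, ∀ (l : ℝ) (p : E →L[ℝ] ℝ), H (y, l • p) = l ^ 2 * H (y, p))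
    {Q : E →L[ℝ] E →L[ℝ] ℝ} (hQ : ∀ x y, Q x y = Q y x)
    {v a K ε : ℝ} {q : ℝ → E} {p : ℝ → E →L[ℝ] ℝ} {u : ℝ → E × (E →L[ℝ] ℝ)} {Kq Kp : NNReal}
    (hv : 0 < v)
    (hz : ∀ t ∈ Ioo a (a + ε), HasDerivAt (fun t ↦ (q t, p t)) (u t) t)
    (hq : LipschitzOnWith Kq q (Icc a (a + ε))) (hp : LipschitzOnWith Kp p (Icc a (a + ε)))
    (hsub : ∀ t ∈ Icc a (a + ε), ∀ y ∈ U,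
      barrierTimeDeriv Q v a K q p (u t) t y + H (y, barrierCovector Q a K q p t y) ≤ 0)
    {y : ℝ → E} {c d : ℝ} (hcd : c < d) (hy : AbsolutelyContinuousOnInterval y c d)
    (hyU : MapsTo y (Icc c d) U) (hyc : p a (y c - q a) ≤ 0) (hyd : y d = q (a + ε))
    {m : ℝ → ℝ≥0∞} (hm : ∀ᵐ t, t ∈ Ioo c d → SpeedLE H y m t) :
    ENNReal.ofReal (v * ε) ≤ ∫⁻ t in Icc c d, m t := by
  have hycont : ContinuousOn y (Icc c d) := uIcc_of_le hcd.le ▸ hy.continuousOn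
  obtain ⟨m', hm'meas, hm'm, hm'⟩ := exists_aemeasurable_speedLE hH hycont hyU hm
  have hle : ∫⁻ t in Icc c d, m' t ≤ ∫⁻ t in Icc c d, m t := by
    rw [setLIntegral_congr Ioo_ae_eq_Icc.symm, setLIntegral_congr Ioo_ae_eq_Icc.symm]
    exact lintegral_mono_ae ((ae_restrict_iff' measurableSet_Ioo).2 hm'm)
  refine le_trans ?_ hle
  by_contra! hlt
  have hfin : ∫⁻ t in Icc c d, m' t ≠ ⊤ := hlt.ne_top
  have hm'top := ae_lt_top' hm'meas hfin
  rw [ae_restrict_iff' measurableSet_Icc] at hm'top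
  -- the total length `L` of the curve, and the slack `κ`
  set L : ℝ := ∫ t in Icc c d, (m' t).toReal with hL
  have hint : IntegrableOn (fun t ↦ (m' t).toReal) (Icc c d) :=
    integrable_toReal_of_lintegral_ne_top hm'meas hfin
  have hLlt : L < v * ε := by
    rw [hL, integral_toReal hm'meas ((ae_restrict_iff' measurableSet_Icc).2 hm'top)]
    exact (ENNReal.lt_ofReal_iff_toReal_lt hfin).1 hlt
  set κ : ℝ := (ε - L / v) / (d - c) with hκ
  have hκ0 : 0 < κ := by
    refine div_pos (sub_pos.2 ?_) (sub_pos.2 hcd)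
    rw [div_lt_iff₀ hv]; linarith
  have hII : IntervalIntegrable (fun t ↦ (m' t).toReal) volume c d := by
    rw [intervalIntegrable_iff_integrableOn_Icc_of_le hcd.le]; exact hint
  have hII' : IntervalIntegrable (fun t ↦ (m' t).toReal / v + κ) volume c d :=
    (hII.div_const v).add intervalIntegrable_const
  let τ : ℝ → ℝ := fun s ↦ a + ∫ t in c..s, ((m' t).toReal / v + κ)
  have hτc : τ c = a := by simp [τ]
  have hτd : τ d = a + ε := by
    simp only [τ]
    rw [intervalIntegral.integral_add (hII.div_const v) intervalIntegrable_const,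
      intervalIntegral.integral_div, intervalIntegral.integral_const,
      intervalIntegral.integral_of_le hcd.le, ← integral_Icc_eq_integral_Ioc, ← hL, hκ, smul_eq_mul,
      mul_div_cancel₀ _ (sub_pos.2 hcd).ne']
    ring
  have hτmono : ∀ s₁ ∈ Icc c d, ∀ s₂ ∈ Icc c d, s₁ < s₂ → τ s₁ < τ s₂ := by
    intro s₁ h₁ s₂ h₂ h12
    have hsub1 : IntervalIntegrable (fun t ↦ (m' t).toReal / v + κ) volume c s₁ :=
      hII'.mono_set (by
        rw [uIcc_of_le hcd.le, uIcc_of_le h₁.1]; exact Icc_subset_Icc_right h₁.2)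
    have hsub2 : IntervalIntegrable (fun t ↦ (m' t).toReal / v + κ) volume s₁ s₂ :=
      hII'.mono_set (by
        rw [uIcc_of_le hcd.le, uIcc_of_le h12.le]; exact Icc_subset_Icc h₁.1 h₂.2)
    simp only [τ]
    rw [← intervalIntegral.integral_add_adjacent_intervals hsub1 hsub2]
    have := intervalIntegral.integral_mono_on h12.le intervalIntegrable_const hsub2
      (f := fun _ ↦ κ) (fun t _ ↦ by
        have : 0 ≤ (m' t).toReal / v := by positivity
        linarith)
    rw [intervalIntegral.integral_const, smul_eq_mul] at this
    nlinarith
  have hτac : AbsolutelyContinuousOnInterval τ c d :=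
    ((LipschitzWith.const a).lipschitzOnWith.absolutelyContinuousOnInterval (K := 0)).add
      (hII'.absolutelyContinuousOnInterval_intervalIntegral left_mem_uIcc)
  have hτA : MapsTo τ (uIcc c d) (Icc a (a + ε)) := by
    rw [uIcc_of_le hcd.le]
    intro s hs
    constructor
    · rcases hs.1.eq_or_lt with rfl | h
      · exact hτc.ge
      · exact hτc ▸ (hτmono c (left_mem_Icc.2 hcd.le) s hs h).le
    · rcases hs.2.eq_or_lt with rfl | h
      · exact hτd.le
      · exact hτd ▸ (hτmono s hs d (right_mem_Icc.2 hcd.le) h).le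
  let h : ℝ → ℝ := fun s ↦ barrier Q v a K q p (τ s) (y s)
  have hac : AbsolutelyContinuousOnInterval h c d :=
    absolutelyContinuousOnInterval_barrier_comp hq hp hτac hτA hy
  have hderiv : ∀ᵐ t, t ∈ Ioo c d → ENNReal.ofReal (deriv h t) ≤ ENNReal.ofReal (v / 2) * m' t := by
    filter_upwards [hm'top, hII'.ae_hasDerivAt_integral,
      hy.boundedVariationOn.ae_differentiableAt_of_mem_uIcc] with t htop hτt hyt ht
    have htI := Ioo_subset_Icc_self ht
    have htu : t ∈ uIcc c d := by rwa [uIcc_of_le hcd.le]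
    have hτI : τ t ∈ Ioo a (a + ε) :=
      ⟨hτc ▸ hτmono c (left_mem_Icc.2 hcd.le) t htI ht.1,
        hτd ▸ hτmono t htI d (right_mem_Icc.2 hcd.le) ht.2⟩
    have hτ' : HasDerivAt τ ((m' t).toReal / v + κ) t := (hτt htu c left_mem_uIcc).const_add a
    have hh := hasDerivAt_barrier_comp (v := v) (a := a) (K := K) hQ hτ' (hyt htu).hasDerivAt
      (hz _ hτI)
    have hm'v : 0 ≤ (m' t).toReal / v := by positivity
    have hτpos : 0 < (m' t).toReal / v + κ := by linarith
    -- the weight `τ'` matches the Hamiltonian term of the subsolution inequality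
    have h1 := (hm' t htI).apply_le (hhom _ (hyU htI)) (htop htI).ne
      (barrierCovector Q a K q p (τ t) (y t)) hτpos
    have h2 := hsub (τ t) (Ioo_subset_Icc_self hτI) (y t) (hyU htI)
    have h3 : (m' t).toReal ^ 2 / (2 * ((m' t).toReal / v + κ)) ≤ v / 2 * (m' t).toReal := by
      rw [div_le_iff₀ (by positivity)]
      have : v / 2 * (m' t).toReal * (2 * ((m' t).toReal / v + κ))
          = (m' t).toReal ^ 2 + v * κ * (m' t).toReal := by field_simp
      rw [this]
      have : 0 ≤ v * κ * (m' t).toReal := by positivity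
      linarith
    rw [hh.deriv]
    calc _ ≤ ENNReal.ofReal (v / 2 * (m' t).toReal) := ENNReal.ofReal_le_ofReal (by nlinarith)
      _ = _ := by rw [ENNReal.ofReal_mul (by positivity), ENNReal.ofReal_toReal (htop htI).ne]
  have key := hac.ofReal_sub_le_lintegral hcd.le hderiv
  rw [lintegral_const_mul' _ _ ENNReal.ofReal_ne_top] at key
  have hhd : h d = v ^ 2 / 2 * ε := by simp [h, barrier, hτd, hyd]
  have hhc : h c ≤ 0 := by simpa [h, barrier, hτc] using hyc
  have h4 : ENNReal.ofReal (v / 2) * ENNReal.ofReal (v * ε) ≤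
      ENNReal.ofReal (v / 2) * ∫⁻ t in Icc c d, m' t := by
    refine le_trans ?_ key
    rw [← ENNReal.ofReal_mul (by positivity)]
    exact ENNReal.ofReal_le_ofReal (by rw [hhd]; linarith)
  rw [ENNReal.mul_le_mul_iff_right (by positivity) ENNReal.ofReal_ne_top] at h4
  exact absurd hlt (not_lt.2 h4)

/-- A lower bound of the length in terms of the displacement in a chart: if `H ≤ C` on the unit
covectors, then `|y'| ≤ √(2C) m`, which is weakened here to `(C + 1) m`. -/
theorem ofReal_norm_sub_le_lintegral [FiniteDimensional ℝ E] {H : E × (E →L[ℝ] ℝ) → ℝ}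
    {U : Set E} {C : ℝ} (hC0 : 0 ≤ C) (hC : ∀ y ∈ U, ∀ p : E →L[ℝ] ℝ, ‖p‖ ≤ 1 → H (y, p) ≤ C)
    (hhom : ∀ y ∈ U, ∀ (l : ℝ) (p : E →L[ℝ] ℝ), H (y, l • p) = l ^ 2 * H (y, p))
    {y : ℝ → E} {c d : ℝ} (hcd : c ≤ d) (hy : AbsolutelyContinuousOnInterval y c d)
    (hyU : MapsTo y (Ioo c d) U) {m : ℝ → ℝ≥0∞} (hm : ∀ᵐ t, t ∈ Ioo c d → SpeedLE H y m t) :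
    ENNReal.ofReal ‖y d - y c‖ ≤ ENNReal.ofReal (C + 1) * ∫⁻ t in Icc c d, m t := by
  obtain ⟨p, hp1, hp⟩ := exists_dual_vector'' ℝ (y d - y c)
  have hp' : ‖y d - y c‖ = p (y d) - p (y c) := by rw [← map_sub, hp]; simp
  have hac := p.comp_absolutelyContinuousOnInterval hy
  rw [hp', ← lintegral_const_mul' _ _ ENNReal.ofReal_ne_top]
  refine hac.ofReal_sub_le_lintegral hcd ?_
  filter_upwards [hm, hy.boundedVariationOn.ae_differentiableAt_of_mem_uIcc] with t htm hyt ht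
  have htu : t ∈ uIcc c d := by rw [uIcc_of_le hcd]; exact Ioo_subset_Icc_self ht
  have hd : deriv (fun t ↦ p (y t)) t = p (deriv y t) :=
    (p.hasFDerivAt.comp_hasDerivAt t (hyt htu).hasDerivAt).deriv
  rw [hd]
  by_cases htop : m t = ⊤
  · rw [htop, ENNReal.mul_top (ENNReal.ofReal_pos.2 (by linarith)).ne']
    exact le_top
  have hU := hyU ht
  have key : ∀ l : ℝ, 0 < l → p (deriv y t) ≤ l * C + (m t).toReal ^ 2 / (2 * l) := fun l hl ↦
    ((htm ht).apply_le (hhom _ hU) htop p hl).trans (by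
      have := hC _ hU p hp1
      gcongr)
  rw [← ENNReal.ofReal_toReal htop, ← ENNReal.ofReal_mul (by linarith)]
  refine ENNReal.ofReal_le_ofReal ?_
  rcases (ENNReal.toReal_nonneg (a := m t)).eq_or_lt with h0 | h0
  -- at speed zero the weight `l` tends to zero; otherwise `l = m` is taken
  · rw [← h0, mul_zero]
    refine le_of_forall_pos_le_add fun η hη ↦ ?_
    have := key (η / (C + 1)) (by positivity)
    rw [← h0] at this
    have h2 : η / (C + 1) * C ≤ η := by
      rw [div_mul_eq_mul_div, div_le_iff₀ (by positivity)]; nlinarith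
    have h3 : (0:ℝ) ^ 2 / (2 * (η / (C + 1))) = 0 := by simp
    linarith
  · have := key _ h0
    have h3 : (m t).toReal ^ 2 / (2 * (m t).toReal) = (m t).toReal / 2 := by field_simp
    nlinarith

end SubRiem

namespace SubRiem

variable {E : Type*} [NormedAddCommGroup E] [NormedSpace ℝ E]
  {M : Type*} [TopologicalSpace M] [ChartedSpace E M]

/-! ### The differential of a chart -/

section chart

theorem mdifferentiable_of_mem_maximalAtlas {φ : OpenPartialHomeomorph M E}
    (hφ : φ ∈ IsManifold.maximalAtlas 𝓘(ℝ, E) ∞ M) : φ.MDifferentiable 𝓘(ℝ, E) 𝓘(ℝ, E) :=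
  ⟨(contMDiffOn_of_mem_maximalAtlas hφ).mdifferentiableOn (by simp),
    (contMDiffOn_symm_of_mem_maximalAtlas hφ).mdifferentiableOn (by simp)⟩

theorem chartDifferential_isInvertible {φ : OpenPartialHomeomorph M E}
    (hφ : φ ∈ IsManifold.maximalAtlas 𝓘(ℝ, E) ∞ M) {x : M} (hx : x ∈ φ.source) :
    (chartDifferential φ x).IsInvertible :=
  ⟨(mdifferentiable_of_mem_maximalAtlas hφ).mfderiv hx, rfl⟩

theorem comp_inverse_comp_chartDifferential {φ : OpenPartialHomeomorph M E}
    (hφ : φ ∈ IsManifold.maximalAtlas 𝓘(ℝ, E) ∞ M) {x : M} (hx : x ∈ φ.source)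
    (α : CotangentSpace E x) :
    (α.comp (chartDifferential φ x).inverse).comp (chartDifferential φ x) = α := by
  obtain ⟨e, he⟩ := chartDifferential_isInvertible hφ hx
  rw [← he, ContinuousLinearMap.inverse_equiv]
  ext v
  simp

/-- A smooth vector field is smooth when read in a chart. -/
theorem SmoothVectorFieldOn.contDiffAt_chart [IsManifold 𝓘(ℝ, E) ∞ M]
    {φ : OpenPartialHomeomorph M E}
    (hφ : φ ∈ IsManifold.maximalAtlas 𝓘(ℝ, E) ∞ M) {X : ∀ x : M, TangentSpace 𝓘(ℝ, E) x}
    {U : Set M} (hU : IsOpen U) (hX : SmoothVectorFieldOn X U) {y : E} (hy : y ∈ φ.target)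
    (hyU : φ.symm y ∈ U) :
    ContDiffAt ℝ ∞ (fun y ↦ chartDifferential φ (φ.symm y) (X (φ.symm y))) y := by
  have h1 := (contMDiffOn_of_mem_maximalAtlas hφ).contMDiffOn_tangentMapWithin (m := ∞)
    (by simp) φ.open_source.uniqueMDiffOn
  have h2 : ContMDiffOn 𝓘(ℝ, E) 𝓘(ℝ, E) ∞
      (fun x ↦ (tangentMapWithin 𝓘(ℝ, E) 𝓘(ℝ, E) φ φ.source
        (⟨x, X x⟩ : TangentBundle 𝓘(ℝ, E) M)).2) (U ∩ φ.source) :=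
    (contMDiff_snd_tangentBundle_modelSpace E 𝓘(ℝ, E)).comp_contMDiffOn
      (h1.comp (hX.mono inter_subset_left) fun x hx ↦ hx.2)
  have h3 := (h2.contMDiffAt ((hU.inter φ.open_source).mem_nhds ⟨hyU, φ.map_target hy⟩)).comp y
    (contMDiffAt_symm_of_mem_maximalAtlas hφ hy)
  refine h3.contDiffAt.congr_of_eventuallyEq ?_
  filter_upwards [φ.open_target.mem_nhds hy] with z hz
  simp only [Function.comp, tangentMapWithin, chartDifferential]
  rw [mfderivWithin_of_isOpen φ.open_source (φ.map_target hz)]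
  rfl

end chart

/-! ### The sub-Riemannian Hamiltonian -/

namespace SubRiemannianStructure

variable [IsManifold 𝓘(ℝ, E) ∞ M] [FiniteDimensional ℝ E] (S : SubRiemannianStructure E M)

/-- The horizontal vector that represents the restriction of the covector `p` to the distribution;
it is the velocity prescribed by the Hamiltonian at `p`. -/
noncomputable def horizontalDual (x : M) (p : CotangentSpace E x) : S.D x :=
  S.sharp x (p.toLinearMap.domRestrict (S.D x))

theorem g_horizontalDual (x : M) (p : CotangentSpace E x) (v : S.D x) :
    S.g x (S.horizontalDual x p) v = p v :=
  LinearMap.BilinForm.apply_toDual_symm_apply (hB := S.g_nondegenerate x) _ _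

theorem eq_horizontalDual {x : M} {p : CotangentSpace E x} {w : S.D x}
    (h : ∀ v : S.D x, S.g x w v = p v) : w = S.horizontalDual x p := by
  rw [← sub_eq_zero]
  refine (S.g_nondegenerate x).1 _ fun v ↦ ?_
  rw [map_sub, LinearMap.sub_apply, h, g_horizontalDual, sub_self]

theorem hamiltonian_eq_g (x : M) (p : CotangentSpace E x) :
    S.hamiltonian x p = 1 / 2 * S.g x (S.horizontalDual x p) (S.horizontalDual x p) := rfl

theorem hamiltonian_eq (x : M) (p : CotangentSpace E x) :
    S.hamiltonian x p = 1 / 2 * p (S.horizontalDual x p) := by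
  rw [hamiltonian_eq_g, g_horizontalDual]

theorem hamiltonian_nonneg (x : M) (p : CotangentSpace E x) : 0 ≤ S.hamiltonian x p := by
  rw [hamiltonian_eq_g]
  by_cases h : S.horizontalDual x p = 0
  · simp [h]
  · have := S.g_pos x _ h
    positivity

theorem horizontalDual_add_smul (x : M) (p r : CotangentSpace E x) (l : ℝ) :
    S.horizontalDual x (p + l • r) = S.horizontalDual x p + l • S.horizontalDual x r := by
  symm
  refine S.eq_horizontalDual fun v ↦ ?_
  simp [g_horizontalDual]

theorem hamiltonian_smul (x : M) (l : ℝ) (p : CotangentSpace E x) :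
    S.hamiltonian x (l • p) = l ^ 2 * S.hamiltonian x p := by
  have h : S.horizontalDual x (l • p) = l • S.horizontalDual x p := by
    symm
    refine S.eq_horizontalDual fun v ↦ ?_
    simp [g_horizontalDual]
  rw [hamiltonian_eq_g, hamiltonian_eq_g, h]
  simp only [map_smul, LinearMap.smul_apply, smul_eq_mul]
  ring

theorem hamiltonian_add_smul (x : M) (p r : CotangentSpace E x) (l : ℝ) :
    S.hamiltonian x (p + l • r)
      = S.hamiltonian x p + l * r (S.horizontalDual x p) + l ^ 2 * S.hamiltonian x r := by
  have h1 := S.g_horizontalDual x r (S.horizontalDual x p)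
  have h2 := S.g_symm x (S.horizontalDual x p) (S.horizontalDual x r)
  simp only [hamiltonian_eq_g, horizontalDual_add_smul, map_add, map_smul, LinearMap.add_apply,
    LinearMap.smul_apply, smul_eq_mul]
  rw [h2, h1]
  ring

/-- The Fenchel–Young inequality for the Hamiltonian. -/
theorem two_mul_sub_hamiltonian_le (x : M) (p : CotangentSpace E x) (v : S.D x) :
    2 * (p v - S.hamiltonian x p) ≤ S.g x v v := by
  have h : 0 ≤ S.g x (v - S.horizontalDual x p) (v - S.horizontalDual x p) := by
    by_cases h0 : v - S.horizontalDual x p = 0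
    · simp [h0]
    · exact (S.g_pos x _ h0).le
  have h1 := S.g_horizontalDual x p v
  have h2 := S.g_symm x v (S.horizontalDual x p)
  simp only [map_sub, LinearMap.sub_apply] at h
  rw [hamiltonian_eq_g]
  rw [h2, h1] at h
  linarith

theorem ofReal_le_enorm_sq (x : M) (p : CotangentSpace E x) (v : TangentSpace 𝓘(ℝ, E) x) :
    ENNReal.ofReal (2 * (p v - S.hamiltonian x p)) ≤ S.enorm x v ^ 2 := by
  unfold enorm
  split_ifs with h
  · have h0 : 0 ≤ S.g x ⟨v, h⟩ ⟨v, h⟩ := by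
      by_cases h0 : (⟨v, h⟩ : S.D x) = 0
      · simp [h0]
      · exact (S.g_pos x _ h0).le
    rw [← ENNReal.ofReal_pow (Real.sqrt_nonneg _), Real.sq_sqrt h0]
    exact ENNReal.ofReal_le_ofReal (S.two_mul_sub_hamiltonian_le x p ⟨v, h⟩)
  · simp

theorem enorm_horizontalDual (x : M) (p : CotangentSpace E x) :
    S.enorm x (S.horizontalDual x p) = ENNReal.ofReal (Real.sqrt (2 * S.hamiltonian x p)) := by
  rw [enorm, dif_pos (S.horizontalDual x p).2, hamiltonian_eq_g]
  congr 2
  ring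

/-- The Hamiltonian in terms of the Gram matrix of a basis of the distribution. -/
theorem hamiltonian_eq_dotProduct {ι : Type*} [Fintype ι] [DecidableEq ι] (x : M)
    (B : Module.Basis ι ℝ (S.D x)) (p : CotangentSpace E x) :
    S.hamiltonian x p = 1 / 2 * (fun i ↦ p (B i)) ⬝ᵥ
      ((Matrix.of fun i j ↦ S.g x (B i) (B j))⁻¹.mulVec fun i ↦ p (B i)) := by
  set G : Matrix ι ι ℝ := Matrix.of fun i j ↦ S.g x (B i) (B j) with hG
  have hdet : IsUnit G.det := by
    rw [isUnit_iff_ne_zero]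
    have := (LinearMap.BilinForm.nondegenerate_iff_det_ne_zero B).1 (S.g_nondegenerate x)
    convert this using 2
    ext i j
    simp [hG, LinearMap.BilinForm.toMatrix_apply]
  set c := G⁻¹.mulVec fun i ↦ p (B i) with hc
  have hGc : G.mulVec c = fun i ↦ p (B i) := by
    rw [hc, Matrix.mulVec_mulVec, Matrix.mul_nonsing_inv _ hdet, Matrix.one_mulVec]
  have hdual : ∑ j, c j • B j = S.horizontalDual x p := by
    refine S.eq_horizontalDual fun v ↦ ?_
    have hlin : S.g x (∑ j, c j • B j) = p.toLinearMap.domRestrict (S.D x) := by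
      refine B.ext fun i ↦ ?_
      have := congrFun hGc i
      simp only [Matrix.mulVec, dotProduct, hG, Matrix.of_apply] at this
      simp only [map_sum, map_smul, LinearMap.sum_apply, LinearMap.smul_apply, smul_eq_mul,
        LinearMap.domRestrict_apply, ContinuousLinearMap.coe_coe]
      rw [← this]
      exact Finset.sum_congr rfl fun j _ ↦ by rw [S.g_symm x (B i) (B j), mul_comm]
    rw [hlin]; rfl
  rw [hamiltonian_eq, ← hdual]
  simp [dotProduct, mul_comm]

end SubRiemannianStructure

theorem contDiffAt_matrix_inv {V ι : Type*} [NormedAddCommGroup V] [NormedSpace ℝ V] [Fintype ι]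
    [DecidableEq ι] {n : WithTop ℕ∞} {A : V → Matrix ι ι ℝ} {z : V}
    (hA : ∀ i j, ContDiffAt ℝ n (fun y ↦ A y i j) z) (hdet : (A z).det ≠ 0) (i j : ι) :
    ContDiffAt ℝ n (fun y ↦ (A y)⁻¹ i j) z := by
  have hd : ∀ B : V → Matrix ι ι ℝ, (∀ i j, ContDiffAt ℝ n (fun y ↦ B y i j) z) →
      ContDiffAt ℝ n (fun y ↦ (B y).det) z := fun B hB ↦ by
    simp only [Matrix.det_apply']
    exact ContDiffAt.sum fun σ _ ↦ contDiffAt_const.mul (contDiffAt_prod fun i _ ↦ hB _ _)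
  simp only [Matrix.inv_def, Matrix.smul_apply, Ring.inverse_eq_inv', smul_eq_mul,
    Matrix.adjugate_apply]
  refine ((hd A hA).inv hdet).mul (hd _ fun k l ↦ ?_)
  simp only [Matrix.updateRow_apply]
  split_ifs
  · exact contDiffAt_const
  · exact hA k l

/-- The sub-Riemannian Hamiltonian is smooth in canonical coordinates. -/
theorem SubRiemannianStructure.contDiffAt_hamiltonianInChart [IsManifold 𝓘(ℝ, E) ∞ M]
    [FiniteDimensional ℝ E] (S : SubRiemannianStructure E M) {φ : OpenPartialHomeomorph M E}
    (hφ : φ ∈ IsManifold.maximalAtlas 𝓘(ℝ, E) ∞ M) {z : E × (E →L[ℝ] ℝ)} (hz : z.1 ∈ φ.target) :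
    ContDiffAt ℝ ∞ (hamiltonianInChart S.hamiltonian φ) z := by
  classical
  obtain ⟨U, hU, hzU, X, hX, hXD⟩ := S.exists_frame (φ.symm z.1)
  have hmem : ∀ x ∈ U, ∀ i, X i x ∈ S.D x := fun x hx i ↦
    (hXD x hx).2 ▸ Submodule.subset_span (mem_range_self i)
  let Y : Fin S.rank → ∀ x, S.D x := fun i x ↦ if h : X i x ∈ S.D x then ⟨X i x, h⟩ else 0
  have hYX : ∀ x ∈ U, ∀ i, (Y i x : TangentSpace 𝓘(ℝ, E) x) = X i x := fun x hx i ↦ by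
    simp [Y, hmem x hx i]
  have hYs : ∀ i, SmoothVectorFieldOn (fun x ↦ (Y i x : TangentSpace 𝓘(ℝ, E) x)) U := fun i ↦
    ContMDiffOn.congr (hX i) fun x hx ↦ by simp only [hYX x hx i]
  let G : E → Matrix (Fin S.rank) (Fin S.rank) ℝ := fun y ↦
    Matrix.of fun i j ↦ S.g (φ.symm y) (Y i (φ.symm y)) (Y j (φ.symm y))
  let ξ : Fin S.rank → E → E := fun i y ↦ chartDifferential φ (φ.symm y) (X i (φ.symm y))
  have hξ : ∀ i, ContDiffAt ℝ ∞ (ξ i) z.1 := fun i ↦ (hX i).contDiffAt_chart hφ hU hz hzU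
  have hG : ∀ i j, ContDiffAt ℝ ∞ (fun y ↦ G y i j) z.1 := fun i j ↦
    (((S.g_smooth U hU _ _ (hYs i) (hYs j)).contMDiffAt (hU.mem_nhds hzU)).comp z.1
      (contMDiffAt_symm_of_mem_maximalAtlas hφ hz)).contDiffAt
  -- the frame is a basis of the distribution at each point of `U`
  have hbasis : ∀ x ∈ U, ∃ B : Module.Basis (Fin S.rank) ℝ (S.D x), ∀ i, B i = Y i x := by
    intro x hx
    have hcoe : (fun i ↦ ((S.D x).subtype) (Y i x)) = fun i ↦ X i x :=
      funext fun i ↦ hYX x hx i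
    have hli : LinearIndependent ℝ fun i ↦ Y i x := by
      refine LinearIndependent.of_comp (S.D x).subtype ?_
      have := (hXD x hx).1
      rw [← hcoe] at this
      exact this
    have hsp : ⊤ ≤ Submodule.span ℝ (range fun i ↦ Y i x) := by
      rw [top_le_iff, ← Submodule.map_injective_of_injective (S.D x).subtype_injective |>.eq_iff,
        Submodule.map_span, ← range_comp, Submodule.map_subtype_top]
      have : ((S.D x).subtype ∘ fun i ↦ Y i x) = fun i ↦ X i x := hcoe
      rw [this, (hXD x hx).2]
    exact ⟨Module.Basis.mk hli hsp, fun i ↦ Module.Basis.mk_apply hli hsp i⟩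
  have hdet : (G z.1).det ≠ 0 := by
    obtain ⟨B, hB⟩ := hbasis _ hzU
    have := (LinearMap.BilinForm.nondegenerate_iff_det_ne_zero B).1 (S.g_nondegenerate _)
    convert this using 2
    ext i j
    simp [G, LinearMap.BilinForm.toMatrix_apply, hB]
  have hpair : ∀ i, ContDiffAt ℝ ∞ (fun w : E × (E →L[ℝ] ℝ) ↦ w.2 (ξ i w.1)) z := fun i ↦
    contDiffAt_snd.clm_apply ((hξ i).comp z contDiffAt_fst)
  have hsmooth : ContDiffAt ℝ ∞ (fun w : E × (E →L[ℝ] ℝ) ↦ 1 / 2 * ∑ i, w.2 (ξ i w.1) *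
      ∑ j, (G w.1)⁻¹ i j * w.2 (ξ j w.1)) z :=
    contDiffAt_const.mul (ContDiffAt.sum fun i _ ↦ (hpair i).mul (ContDiffAt.sum fun j _ ↦
      ((contDiffAt_matrix_inv hG hdet i j).comp z contDiffAt_fst).mul (hpair j)))
  refine hsmooth.congr_of_eventuallyEq ?_
  have hnhds : ∀ᶠ w : E × (E →L[ℝ] ℝ) in nhds z, φ.symm w.1 ∈ U :=
    ((φ.continuousAt_symm hz).comp continuousAt_fst).eventually (hU.mem_nhds hzU)
  filter_upwards [hnhds] with w hw
  obtain ⟨B, hB⟩ := hbasis _ hw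
  rw [hamiltonianInChart, S.hamiltonian_eq_dotProduct _ B]
  simp only [hB, hYX _ hw]
  rfl

end SubRiem

namespace SubRiem

variable {E : Type*} [NormedAddCommGroup E] [NormedSpace ℝ E]
  {M : Type*} [TopologicalSpace M] [ChartedSpace E M]

/-! ### Horizontal curves in a chart -/

theorem hamiltonianInChart_apply (H : ∀ x : M, CotangentSpace E x → ℝ)
    {φ : OpenPartialHomeomorph M E} {x : M} (hx : x ∈ φ.source) (p : E →L[ℝ] ℝ) :
    hamiltonianInChart H φ (φ x, p) = H x (p.comp (chartDifferential φ x)) := by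
  have h : ∀ x', x' = x → H x' (p.comp (chartDifferential φ x'))
      = H x (p.comp (chartDifferential φ x)) := by rintro _ rfl; rfl
  exact h _ (φ.left_inv hx)

theorem hamiltonianInChart_cotangentCoord (H : ∀ x : M, CotangentSpace E x → ℝ)
    {φ : OpenPartialHomeomorph M E} (hφ : φ ∈ IsManifold.maximalAtlas 𝓘(ℝ, E) ∞ M) {x : M}
    (hx : x ∈ φ.source) (α : CotangentSpace E x) :
    hamiltonianInChart H φ (cotangentCoord φ x α) = H x α := by
  rw [cotangentCoord, hamiltonianInChart_apply H hx, comp_inverse_comp_chartDifferential hφ hx]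

/-- The chart maps the velocity of a curve to the derivative of the curve in the chart. -/
theorem chartDifferential_velocity {φ : OpenPartialHomeomorph M E}
    (hφ : φ ∈ IsManifold.maximalAtlas 𝓘(ℝ, E) ∞ M) {μ : ℝ → M} {c d t : ℝ} (ht : t ∈ Ioo c d)
    (hμ : ContinuousOn μ (Icc c d)) (hμt : μ t ∈ φ.source) {w : E}
    (hw : HasDerivAt (fun s ↦ φ (μ s)) w t) :
    chartDifferential φ (μ t) (velocity E μ c d t) = w := by
  have hφd := mdifferentiable_of_mem_maximalAtlas hφ
  have hIcc : Icc c d ∈ nhds t := Icc_mem_nhds ht.1 ht.2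
  have hμc : ContinuousAt μ t := hμ.continuousAt hIcc
  have hy : MDifferentiableAt 𝓘(ℝ, ℝ) 𝓘(ℝ, E) (fun s ↦ φ (μ s)) t :=
    hw.differentiableAt.mdifferentiableAt
  have hμd : MDifferentiableAt 𝓘(ℝ, ℝ) 𝓘(ℝ, E) μ t := by
    refine MDifferentiableAt.congr_of_eventuallyEq
      ((hφd.mdifferentiableAt_symm (φ.map_source hμt)).comp t hy) ?_
    filter_upwards [hμc.eventually (φ.open_source.mem_nhds hμt)] with s hs
    exact (φ.left_inv hs).symm
  have hcomp := mfderiv_comp t (hφd.mdifferentiableAt hμt) hμd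
  rw [velocity, mfderivWithin_of_mem_nhds hIcc, chartDifferential]
  have h1 : mfderiv 𝓘(ℝ, ℝ) 𝓘(ℝ, E) (φ ∘ μ) t (1 : ℝ) = w := by
    rw [mfderiv_eq_fderiv]
    exact hw.deriv
  rw [hcomp] at h1
  exact h1

namespace SubRiemannianStructure

variable [IsManifold 𝓘(ℝ, E) ∞ M] [FiniteDimensional ℝ E] (S : SubRiemannianStructure E M)

theorem hamiltonianInChart_smul (φ : OpenPartialHomeomorph M E) (y : E) (l : ℝ)
    (p : E →L[ℝ] ℝ) : hamiltonianInChart S.hamiltonian φ (y, l • p)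
      = l ^ 2 * hamiltonianInChart S.hamiltonian φ (y, p) := by
  simp only [hamiltonianInChart]
  rw [← S.hamiltonian_smul]
  rfl

/-- The sub-Riemannian norm of the velocity of a curve bounds its speed in a chart. -/
theorem ae_speedLE {φ : OpenPartialHomeomorph M E}
    (hφ : φ ∈ IsManifold.maximalAtlas 𝓘(ℝ, E) ∞ M) {μ : ℝ → M} {c d s : ℝ} (hcs : c ≤ s)
    (hμ : ContinuousOn μ (Icc c d)) (hs : MapsTo μ (Icc s d) φ.source)
    (hac : AbsolutelyContinuousOnInterval (fun t ↦ φ (μ t)) s d) :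
    ∀ᵐ t, t ∈ Ioo s d → SpeedLE (hamiltonianInChart S.hamiltonian φ) (fun t ↦ φ (μ t))
      (fun t ↦ S.enorm (μ t) (velocity E μ c d t)) t := by
  filter_upwards [hac.boundedVariationOn.ae_differentiableAt_of_mem_uIcc] with t hdiff ht p
  have htI := Ioo_subset_Icc_self ht
  have htu : t ∈ uIcc s d := by rwa [uIcc_of_le (ht.1.trans ht.2).le]
  have hv := chartDifferential_velocity hφ ⟨hcs.trans_lt ht.1, ht.2⟩ hμ (hs htI)
    (hdiff htu).hasDerivAt
  rw [hamiltonianInChart_apply _ (hs htI), ← hv]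
  exact S.ofReal_le_enorm_sq (μ t) (p.comp (chartDifferential φ (μ t))) _

theorem exists_hamiltonianInChart_le {φ : OpenPartialHomeomorph M E}
    (hφ : φ ∈ IsManifold.maximalAtlas 𝓘(ℝ, E) ∞ M) {y₀ : E} (hy₀ : y₀ ∈ φ.target) :
    ∃ r > 0, ∃ C : ℝ, 0 ≤ C ∧ ∀ y ∈ Metric.ball y₀ r, ∀ p : E →L[ℝ] ℝ, ‖p‖ ≤ 1 →
      hamiltonianInChart S.hamiltonian φ (y, p) ≤ C := by
  have hcont := (S.contDiffAt_hamiltonianInChart hφ (z := (y₀, 0)) hy₀).continuousAt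
  have hzero : hamiltonianInChart S.hamiltonian φ (y₀, 0) = 0 := by
    simpa using S.hamiltonianInChart_smul φ y₀ 0 0
  obtain ⟨η, hη, h⟩ := Metric.continuousAt_iff.1 hcont 1 one_pos
  refine ⟨η, hη, (2 / η) ^ 2, by positivity, fun y hy p hp ↦ ?_⟩
  have hd : Dist.dist (y, (η / 2) • p) (y₀, 0) < η := by
    rw [Prod.dist_eq, max_lt_iff]
    refine ⟨hy, ?_⟩
    rw [dist_zero_right, norm_smul, Real.norm_of_nonneg (by positivity)]
    nlinarith
  have h1 := (le_abs_self _).trans (h hd).le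
  rw [hzero, sub_zero] at h1
  have h2 := S.hamiltonianInChart_smul φ y (2 / η) ((η / 2) • p)
  rw [smul_smul, div_mul_div_cancel₀ hη.ne', div_self two_ne_zero, one_smul] at h2
  rw [h2]
  exact mul_le_of_le_one_right (by positivity) h1

/-- A horizontal curve that ends near the centre of a chart ball and leaves the ball is long: the
length of its last piece inside the ball is bounded below by the displacement in the chart. -/
theorem mapsTo_or_ofReal_le_length [T2Space M] {φ : OpenPartialHomeomorph M E}
    (hφ : φ ∈ IsManifold.maximalAtlas 𝓘(ℝ, E) ∞ M) {y₀ : E} {r C : ℝ}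
    (hball : Metric.closedBall y₀ (r / 2) ⊆ φ.target) (hr : 0 < r) (hC0 : 0 ≤ C)
    (hC : ∀ y ∈ Metric.ball y₀ r, ∀ p : E →L[ℝ] ℝ, ‖p‖ ≤ 1 →
      hamiltonianInChart S.hamiltonian φ (y, p) ≤ C)
    {μ : ℝ → M} {c d : ℝ} (hμ : S.IsHorizontal μ c d) (hd : μ d ∈ φ.source)
    (hdr : φ (μ d) ∈ Metric.ball y₀ (r / 4)) :
    MapsTo μ (Icc c d) (φ.source ∩ φ ⁻¹' Metric.ball y₀ (r / 2)) ∨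
      ENNReal.ofReal (r / 4) ≤ ENNReal.ofReal (C + 1) * S.length μ c d := by
  set W : Set M := φ.source ∩ φ ⁻¹' Metric.ball y₀ (r / 2) with hW
  have hWo : IsOpen W := φ.isOpen_inter_preimage Metric.isOpen_ball
  have hprop : ProperSpace E := FiniteDimensional.proper ℝ E
  set K : Set M := φ.symm '' Metric.closedBall y₀ (r / 2) with hK
  have hKc : IsClosed K := ((isCompact_closedBall y₀ (r / 2)).image_of_continuousOn
    (φ.continuousOn_symm.mono hball)).isClosed
  have hWK : W ⊆ K := fun x hx ↦ ⟨φ x, Metric.ball_subset_closedBall hx.2, φ.left_inv hx.1⟩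
  have hKs : K ⊆ φ.source := by
    rintro _ ⟨y, hy, rfl⟩; exact φ.map_target (hball hy)
  have hKr : ∀ x ∈ K, φ x ∈ Metric.ball y₀ r := by
    rintro _ ⟨y, hy, rfl⟩
    rw [φ.right_inv (hball hy)]
    exact Metric.closedBall_subset_ball (by linarith) hy
  by_cases hmaps : MapsTo μ (Icc c d) W
  · exact Or.inl hmaps
  right
  -- the last time `s` at which the curve is outside `W`
  have hμc : ContinuousOn μ (Icc c d) := hμ.1.1
  set B : Set ℝ := Icc c d ∩ μ ⁻¹' Wᶜ with hB
  have hBne : B.Nonempty := by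
    simp only [MapsTo, not_forall] at hmaps
    obtain ⟨t, ht, htW⟩ := hmaps
    exact ⟨t, ht, htW⟩
  have hBc : IsCompact B :=
    isCompact_Icc.of_isClosed_subset (hμc.preimage_isClosed_of_isClosed isClosed_Icc
      hWo.isClosed_compl) inter_subset_left
  obtain ⟨s, hsB, hsmax⟩ := hBc.exists_isGreatest hBne
  have hdW : μ d ∈ W := ⟨hd, Metric.ball_subset_ball (by linarith) hdr⟩
  have hsd : s < d := lt_of_le_of_ne hsB.1.2 fun h ↦ hsB.2 (h ▸ hdW)
  have hafter : MapsTo μ (Ioc s d) W := fun t ht ↦ by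
    by_contra h
    exact absurd (hsmax ⟨⟨hsB.1.1.trans ht.1.le, ht.2⟩, h⟩) (not_le.2 ht.1)
  have hsK : μ s ∈ K := by
    rw [← hKc.closure_eq]
    refine ((hμc s hsB.1).mono ?_).mem_closure (s := Ioc s d) ?_ fun t ht ↦ hWK (hafter ht)
    · exact fun t ht ↦ ⟨hsB.1.1.trans ht.1.le, ht.2⟩
    · rw [closure_Ioc hsd.ne]
      exact left_mem_Icc.2 hsd.le
  have hKI : MapsTo μ (Icc s d) K := fun t ht ↦ by
    rcases ht.1.eq_or_lt with rfl | h
    · exact hsK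
    · exact hWK (hafter ⟨h, ht.2⟩)
  have hsrc : MapsTo μ (Icc s d) φ.source := fun t ht ↦ hKs (hKI ht)
  have hac := hμ.1.2 φ hφ s d hsB.1.1 hsd.le le_rfl hsrc
  have key := ofReal_norm_sub_le_lintegral hC0 hC
    (fun y _ l p ↦ S.hamiltonianInChart_smul φ y l p) hsd.le hac
    (fun t ht ↦ hKr _ (hKI (Ioo_subset_Icc_self ht)))
    (S.ae_speedLE hφ hsB.1.1 hμc hsrc hac)
  have hfar : r / 2 ≤ Dist.dist (φ (μ s)) y₀ := by
    by_contra! h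
    exact hsB.2 ⟨hKs hsK, h⟩
  have hdist : r / 4 ≤ ‖φ (μ d) - φ (μ s)‖ := by
    rw [← dist_eq_norm]
    have := dist_triangle_left (φ (μ s)) y₀ (φ (μ d))
    rw [Metric.mem_ball] at hdr
    linarith
  calc ENNReal.ofReal (r / 4) ≤ _ := ENNReal.ofReal_le_ofReal hdist
    _ ≤ _ := key
    _ ≤ _ := by
      gcongr
      exact lintegral_mono_set (Icc_subset_Icc_left hsB.1.1)

end SubRiemannianStructure

/-! ### Normal geodesics -/

theorem _root_.ContDiffAt.continuousAt_norm_fderiv {V : Type*} [NormedAddCommGroup V]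
    [NormedSpace ℝ V] {f : V → ℝ} {z : V} (hf : ContDiffAt ℝ 1 f z) :
    ContinuousAt (fun z ↦ ‖fderiv ℝ f z‖) z :=
  (hf.fderiv_right (m := 0) (by simp)).continuousAt.norm

theorem norm_le_norm_symplecticContraction (u : E × (E →L[ℝ] ℝ)) :
    ‖u‖ ≤ ‖symplecticContraction u‖ := by
  refine max_le ?_ ?_
  · obtain ⟨p, hp1, hp⟩ := exists_dual_vector'' ℝ u.1
    have h := (symplecticContraction u).le_opNorm (0, p)
    have h1 : symplecticContraction u (0, p) = ‖u.1‖ := by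
      simpa [symplecticContraction] using hp
    rw [h1, norm_norm, Prod.norm_mk, norm_zero, max_eq_right (norm_nonneg p)] at h
    exact h.trans (mul_le_of_le_one_right (norm_nonneg _) hp1)
  · refine ContinuousLinearMap.opNorm_le_bound _ (ContinuousLinearMap.opNorm_nonneg _) fun x ↦ ?_
    have h := (symplecticContraction u).le_opNorm (x, 0)
    have h1 : symplecticContraction u (x, 0) = - u.2 x := by
      simp [symplecticContraction]
    rwa [h1, norm_neg, Prod.norm_mk, norm_zero, max_eq_left (norm_nonneg x)] at h

namespace SubRiemannianStructure

variable [IsManifold 𝓘(ℝ, E) ∞ M] [FiniteDimensional ℝ E] {S : SubRiemannianStructure E M} {γ : ℝ → M}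
  {Γ : ∀ t : ℝ, CotangentSpace E (γ t)} {a b : ℝ}

/-- The first Hamilton equation: the position component of the Hamiltonian vector field at a
covector is the horizontal vector dual to the covector. -/
theorem eq_chartDifferential_horizontalDual (S : SubRiemannianStructure E M)
    {φ : OpenPartialHomeomorph M E}
    (hφ : φ ∈ IsManifold.maximalAtlas 𝓘(ℝ, E) ∞ M) {x : M} (hx : x ∈ φ.source)
    {α : CotangentSpace E x} {u : E × (E →L[ℝ] ℝ)}
    (hu : HasFDerivAt (hamiltonianInChart S.hamiltonian φ) (symplecticContraction u)
      (cotangentCoord φ x α)) :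
    u.1 = chartDifferential φ x (S.horizontalDual x α) := by
  refine (SeparatingDual.eq_iff_forall_dual_eq (R := ℝ)).2 fun η ↦ ?_
  have hline : HasDerivAt (fun l : ℝ ↦ cotangentCoord φ x α + l • ((0, η) : E × (E →L[ℝ] ℝ)))
      (0, η) 0 := by
    simpa using ((hasDerivAt_id (0 : ℝ)).smul_const ((0, η) : E × (E →L[ℝ] ℝ))).const_add
      (cotangentCoord φ x α)
  have h1 : HasDerivAt (fun l : ℝ ↦ hamiltonianInChart S.hamiltonian φ
      (cotangentCoord φ x α + l • ((0, η) : E × (E →L[ℝ] ℝ)))) (η u.1) 0 := by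
    have := HasFDerivAt.comp_hasDerivAt (0 : ℝ) (by simpa using hu) hline
    simpa [symplecticContraction, Function.comp_def] using this
  have h2 : (fun l : ℝ ↦ hamiltonianInChart S.hamiltonian φ
      (cotangentCoord φ x α + l • ((0, η) : E × (E →L[ℝ] ℝ)))) =
      fun l ↦ S.hamiltonian x α + l * η (chartDifferential φ x (S.horizontalDual x α))
        + l ^ 2 * S.hamiltonian x (η.comp (chartDifferential φ x)) := by
    funext l
    have h3 : cotangentCoord φ x α + l • ((0, η) : E × (E →L[ℝ] ℝ))
        = (φ x, α.comp (chartDifferential φ x).inverse + l • η) := by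
      simp [cotangentCoord]
    rw [h3, hamiltonianInChart_apply _ hx, ContinuousLinearMap.add_comp,
      ContinuousLinearMap.smul_comp, comp_inverse_comp_chartDifferential hφ hx]
    exact S.hamiltonian_add_smul x α (η.comp (chartDifferential φ x)) l
  rw [h2] at h1
  have h4 := (((hasDerivAt_id (0 : ℝ)).mul_const
    (η (chartDifferential φ x (S.horizontalDual x α)))).const_add (S.hamiltonian x α)).add
    (((hasDerivAt_id (0 : ℝ)).pow 2).mul_const
      (S.hamiltonian x (η.comp (chartDifferential φ x))))
  have h5 := h1.unique h4
  simpa using h5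

theorem IsHamiltonianLift.velocity_eq (hΓ : S.IsHamiltonianLift γ Γ a b) {c d t : ℝ} (hac : a ≤ c)
    (hdb : d ≤ b) (ht : t ∈ Ioo c d) : velocity E γ c d t = S.horizontalDual (γ t) (Γ t) := by
  have hφ := IsManifold.chart_mem_maximalAtlas (I := 𝓘(ℝ, E)) (n := ∞) (γ t)
  have hx := mem_chart_source E (γ t)
  obtain ⟨u, hu, hH⟩ := hΓ.2 _ hφ t ⟨hac.trans ht.1.le, ht.2.le.trans hdb⟩ hx
  have hu1 : HasDerivAt (fun s ↦ chartAt E (γ t) (γ s)) u.1 t :=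
    (hu.hasDerivAt (Icc_mem_nhds (hac.trans_lt ht.1) (ht.2.trans_le hdb))).fst
  have h1 := chartDifferential_velocity hφ ht (hΓ.1.mono (Icc_subset_Icc hac hdb)) hx hu1
  rw [S.eq_chartDifferential_horizontalDual hφ hx hH] at h1
  exact (mdifferentiable_of_mem_maximalAtlas hφ).mfderiv_injective hx h1

theorem IsHamiltonianLift.continuousOn_coord (hΓ : S.IsHamiltonianLift γ Γ a b)
    {φ : OpenPartialHomeomorph M E} (hφ : φ ∈ IsManifold.maximalAtlas 𝓘(ℝ, E) ∞ M) {c d : ℝ}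
    (hac : a ≤ c) (hdb : d ≤ b) (hs : MapsTo γ (Icc c d) φ.source) :
    ContinuousOn (fun t ↦ cotangentCoord φ (γ t) (Γ t)) (Icc c d) := fun t ht ↦ by
  have hsub := Icc_subset_Icc hac hdb
  obtain ⟨u, hu, -⟩ := hΓ.2 φ hφ t (hsub ht) (hs ht)
  exact hu.continuousWithinAt.mono hsub

theorem IsHamiltonianLift.exists_lipschitzOnWith (hΓ : S.IsHamiltonianLift γ Γ a b)
    {φ : OpenPartialHomeomorph M E} (hφ : φ ∈ IsManifold.maximalAtlas 𝓘(ℝ, E) ∞ M) {c d : ℝ}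
    (hac : a ≤ c) (hdb : d ≤ b) (hs : MapsTo γ (Icc c d) φ.source) :
    ∃ K, LipschitzOnWith K (fun t ↦ cotangentCoord φ (γ t) (Γ t)) (Icc c d) := by
  have hsub := Icc_subset_Icc hac hdb
  have hcont := hΓ.continuousOn_coord hφ hac hdb hs
  have hfd : ContinuousOn (fun t ↦ ‖fderiv ℝ (hamiltonianInChart S.hamiltonian φ)
      (cotangentCoord φ (γ t) (Γ t))‖) (Icc c d) := fun t ht ↦ by
    have h := S.contDiffAt_hamiltonianInChart hφ (z := cotangentCoord φ (γ t) (Γ t))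
      (φ.map_source (hs ht))
    exact ContinuousAt.comp_continuousWithinAt (f := fun t ↦ cotangentCoord φ (γ t) (Γ t))
      (h.of_le (by simp)).continuousAt_norm_fderiv (hcont t ht)
  obtain ⟨C, hC⟩ := isCompact_Icc.exists_bound_of_continuousOn hfd
  choose! u hu hH using fun t (ht : t ∈ Icc c d) ↦ hΓ.2 φ hφ t (hsub ht) (hs ht)
  refine ⟨C.toNNReal, (convex_Icc c d).lipschitzOnWith_of_nnnorm_hasDerivWithin_le
    (fun t ht ↦ (hu t ht).mono hsub) fun t ht ↦ ?_⟩
  rw [← NNReal.coe_le_coe, coe_nnnorm]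
  refine ((norm_le_norm_symplecticContraction _).trans ?_).trans (Real.le_coe_toNNReal C)
  rw [← (hH t ht).fderiv]
  exact (Real.le_norm_self _).trans (hC t ht)

theorem IsHamiltonianLift.isHorizontal (hΓ : S.IsHamiltonianLift γ Γ a b) {d : ℝ} (hdb : d ≤ b) :
    S.IsHorizontal γ a d := by
  refine ⟨⟨hΓ.1.mono (Icc_subset_Icc_right hdb), fun φ hφ s t has hst htd hs ↦ ?_⟩, ?_⟩
  · obtain ⟨K, hK⟩ := hΓ.exists_lipschitzOnWith hφ has (htd.trans hdb) hs
    have h : LipschitzOnWith (1 * K) (fun t ↦ φ (γ t)) (Icc s t) :=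
      (LipschitzWith.prod_fst.lipschitzOnWith (s := univ)).comp hK (mapsTo_univ _ _)
    rw [← uIcc_of_le hst] at h
    exact h.absolutelyContinuousOnInterval
  · rw [← restrict_Ioo_eq_restrict_Icc, ae_restrict_iff' measurableSet_Ioo]
    refine Filter.Eventually.of_forall fun t ht ↦ ?_
    rw [hΓ.velocity_eq le_rfl hdb ht]
    exact (S.horizontalDual (γ t) (Γ t)).2

/-- The Hamiltonian is constant along a Hamiltonian lift. -/
theorem IsHamiltonianLift.hamiltonian_eq (hΓ : S.IsHamiltonianLift γ Γ a b)
    {φ : OpenPartialHomeomorph M E} (hφ : φ ∈ IsManifold.maximalAtlas 𝓘(ℝ, E) ∞ M) {d t : ℝ}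
    (hdb : d ≤ b) (hs : MapsTo γ (Icc a d) φ.source) (ht : t ∈ Icc a d) :
    S.hamiltonian (γ t) (Γ t) = S.hamiltonian (γ a) (Γ a) := by
  have hd : ∀ s ∈ Icc a d, HasDerivWithinAt (fun s ↦ hamiltonianInChart S.hamiltonian φ
      (cotangentCoord φ (γ s) (Γ s))) 0 (Icc a d) s := fun s hsI ↦ by
    obtain ⟨u, hu, hH⟩ := hΓ.2 φ hφ s (Icc_subset_Icc_right hdb hsI) (hs hsI)
    have h := hH.comp_hasDerivWithinAt s (hu.mono (Icc_subset_Icc_right hdb))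
    have h0 : symplecticContraction u u = 0 := by simp [symplecticContraction]
    rwa [h0] at h
  have hconst := constant_of_has_deriv_right_zero (fun s hsI ↦ (hd s hsI).continuousWithinAt)
    (fun s hsI ↦ (hd s (Ico_subset_Icc_self hsI)).mono_of_mem_nhdsWithin
      (Icc_mem_nhdsGE_of_mem hsI)) t ht
  rwa [hamiltonianInChart_cotangentCoord _ hφ (hs ht), hamiltonianInChart_cotangentCoord _ hφ
    (hs (left_mem_Icc.2 (ht.1.trans ht.2)))] at hconst

theorem IsHamiltonianLift.length_eq (hΓ : S.IsHamiltonianLift γ Γ a b)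
    {φ : OpenPartialHomeomorph M E} (hφ : φ ∈ IsManifold.maximalAtlas 𝓘(ℝ, E) ∞ M) {d : ℝ}
    (hdb : d ≤ b) (hs : MapsTo γ (Icc a d) φ.source) :
    S.length γ a d = ENNReal.ofReal (Real.sqrt (2 * S.hamiltonian (γ a) (Γ a)) * (d - a)) := by
  rw [length, ← restrict_Ioo_eq_restrict_Icc,
    setLIntegral_congr_fun (g := fun _ ↦ ENNReal.ofReal (Real.sqrt (2 * S.hamiltonian (γ a) (Γ a))))
      measurableSet_Ioo fun t ht ↦ ?_]
  · rw [setLIntegral_const, Real.volume_Ioo, ENNReal.ofReal_mul (Real.sqrt_nonneg _)]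
  · simp only
    rw [hΓ.velocity_eq le_rfl hdb ht, enorm_horizontalDual,
      hΓ.hamiltonian_eq hφ hdb hs (Ioo_subset_Icc_self ht)]

end SubRiemannianStructure

end SubRiem

namespace SubRiem

variable {E : Type*} [NormedAddCommGroup E] [NormedSpace ℝ E]
  {M : Type*} [TopologicalSpace M] [ChartedSpace E M]

/-! ### Embedded submanifolds -/

/-- Around each of its points, an embedded submanifold is a linear slice in a suitable chart. Hence
a covector that annihilates its tangent space annihilates the displacements within it. -/
theorem exists_chart_annihilating {F : Type*} [NormedAddCommGroup F] [NormedSpace ℝ F]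
    {N : Type*} [TopologicalSpace N] [ChartedSpace F N] {ι : N → M}
    (hι : Manifold.IsSmoothEmbedding 𝓘(ℝ, F) 𝓘(ℝ, E) ∞ ι) {x : M} (hx : x ∈ range ι)
    (α : CotangentSpace E x)
    (hα : ∀ w : TangentSpace 𝓘(ℝ, E) x, (⟨x, w⟩ : TangentBundle 𝓘(ℝ, E) M) ∈
      range (tangentMap 𝓘(ℝ, F) 𝓘(ℝ, E) ι) → α w = 0) :
    ∃ φ ∈ IsManifold.maximalAtlas 𝓘(ℝ, E) ∞ M, x ∈ φ.source ∧ ∃ V ∈ nhds x,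
      ∀ y ∈ V ∩ range ι, (cotangentCoord φ x α).2 (φ y - φ x) = 0 := by
  obtain ⟨n₀, rfl⟩ := hx
  have him := hι.isImmersion.isImmersionAt n₀
  have hφ := him.codChart_mem_maximalAtlas
  have hψ := him.domChart_mem_maximalAtlas
  have hn₀ := him.mem_domChart_source
  have hx := him.mem_codChart_source
  have hslice : ∀ n ∈ him.domChart.source,
      him.codChart (ι n) = him.equiv (him.domChart n, 0) := fun n hn ↦ by
    have := him.writtenInCharts (show him.domChart n ∈ (him.domChart.extend 𝓘(ℝ, F)).target by
      simpa using him.domChart.map_source hn)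
    simpa [hn] using this
  refine ⟨him.codChart, hφ, hx, ?_⟩
  obtain ⟨V, hV, hVι⟩ := hι.isEmbedding.isOpen_iff.1 him.domChart.open_source
  refine ⟨V, hV.mem_nhds (by rw [← mem_preimage, hVι]; exact hn₀), ?_⟩
  rintro _ ⟨hyV, n, rfl⟩
  have hn : n ∈ him.domChart.source := by rwa [← hVι]
  have hφd := mdifferentiable_of_mem_maximalAtlas hφ
  have hψd := mdifferentiable_of_mem_maximalAtlas hψ
  -- the differential of the slice: `dφ (dι w) = (dψ w, 0)`
  have hcomp : (mfderiv 𝓘(ℝ, E) 𝓘(ℝ, E) him.codChart (ι n₀)).comp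
      (mfderiv 𝓘(ℝ, F) 𝓘(ℝ, E) ι n₀) =
      (him.equiv.toContinuousLinearMap.comp (ContinuousLinearMap.inl ℝ F him.complement)).comp
        (mfderiv 𝓘(ℝ, F) 𝓘(ℝ, F) him.domChart n₀) := by
    have hιd : MDifferentiableAt 𝓘(ℝ, F) 𝓘(ℝ, E) ι n₀ := him.contMDiffAt.mdifferentiableAt (by simp)
    rw [← mfderiv_comp n₀ (hφd.mdifferentiableAt hx) hιd]
    have hL := (him.equiv.toContinuousLinearMap.comp
      (ContinuousLinearMap.inl ℝ F him.complement)).hasMFDerivAt (x := him.domChart n₀)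
    have hLc := hL.comp n₀ (hψd.mdifferentiableAt hn₀).hasMFDerivAt
    refine (hLc.congr_of_eventuallyEq ?_).mfderiv
    filter_upwards [him.domChart.open_source.mem_nhds hn₀] with n hn
    simp [hslice n hn]
  obtain ⟨w, hw⟩ := hψd.mfderiv_surjective hn₀ (him.domChart n - him.domChart n₀)
  have h0 : α (mfderiv 𝓘(ℝ, F) 𝓘(ℝ, E) ι n₀ w) = 0 :=
    hα _ ⟨⟨n₀, w⟩, rfl⟩
  rw [← comp_inverse_comp_chartDifferential hφ hx α] at h0
  have h1 : chartDifferential him.codChart (ι n₀) (mfderiv 𝓘(ℝ, F) 𝓘(ℝ, E) ι n₀ w)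
      = him.codChart (ι n) - him.codChart (ι n₀) := by
    have := DFunLike.congr_fun hcomp w
    rw [hslice n hn, hslice n₀ hn₀, ← map_sub, Prod.mk_sub_mk, sub_zero, ← hw]
    exact this
  rw [← h1]
  exact h0

/-! ### Minimality -/

namespace SubRiemannianStructure

variable [IsManifold 𝓘(ℝ, E) ∞ M] [FiniteDimensional ℝ E] {S : SubRiemannianStructure E M} {γ : ℝ → M}
  {Γ : ∀ t : ℝ, CotangentSpace E (γ t)} {a b : ℝ}

/-- Any horizontal curve from `P` to a point of a Hamiltonian curve `γ` close to `γ a` is at least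
as long as `γ`, if the initial covector annihilates `P` in a chart. -/
theorem IsHamiltonianLift.exists_ofReal_le_length [T2Space M] (hab : a < b)
    (hΓ : S.IsHamiltonianLift γ Γ a b) {φ : OpenPartialHomeomorph M E}
    (hφ : φ ∈ IsManifold.maximalAtlas 𝓘(ℝ, E) ∞ M) (hs : MapsTo γ (Icc a b) φ.source)
    {P V : Set M} (hV : V ∈ nhds (γ a))
    (hP : ∀ x ∈ V ∩ P, (cotangentCoord φ (γ a) (Γ a)).2 (φ x - φ (γ a)) = 0)
    (hpos : 0 < S.hamiltonian (γ a) (Γ a)) :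
    ∃ ε₀ > 0, a + ε₀ ≤ b ∧ ∀ ε, 0 < ε → ε ≤ ε₀ → ∀ (μ : ℝ → M) (c d : ℝ), c < d →
      S.IsHorizontal μ c d → μ c ∈ P → μ d = γ (a + ε) →
      ENNReal.ofReal (Real.sqrt (2 * S.hamiltonian (γ a) (Γ a)) * ε) ≤ S.length μ c d := by
  set v := Real.sqrt (2 * S.hamiltonian (γ a) (Γ a)) with hv
  have hv0 : 0 < v := Real.sqrt_pos.2 (by positivity)
  have hv2 : v ^ 2 = 2 * S.hamiltonian (γ a) (Γ a) := Real.sq_sqrt (by positivity)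
  set H := hamiltonianInChart S.hamiltonian φ with hH
  have ha : a ∈ Icc a b := left_mem_Icc.2 hab.le
  set y₀ := φ (γ a) with hy₀
  have hy₀t : y₀ ∈ φ.target := φ.map_source (hs ha)
  let q : ℝ → E := fun t ↦ φ (γ t)
  let p : ℝ → E →L[ℝ] ℝ := fun t ↦ (cotangentCoord φ (γ t) (Γ t)).2
  have hcoord := hΓ.continuousOn_coord hφ le_rfl le_rfl hs
  choose! u hu huH using fun t (ht : t ∈ Icc a b) ↦ hΓ.2 φ hφ t ht (hs ht)
  obtain ⟨L, hL⟩ := hΓ.exists_lipschitzOnWith hφ le_rfl le_rfl hs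
  have hq : LipschitzOnWith (1 * L) q (Icc a b) :=
    (LipschitzWith.prod_fst.lipschitzOnWith (s := univ)).comp hL (mapsTo_univ _ _)
  have hp : LipschitzOnWith (1 * L) p (Icc a b) :=
    (LipschitzWith.prod_snd.lipschitzOnWith (s := univ)).comp hL (mapsTo_univ _ _)
  have hen : ∀ t ∈ Icc a b, S.hamiltonian (γ t) (Γ t) = v ^ 2 / 2 := fun t ht ↦ by
    rw [hΓ.hamiltonian_eq hφ le_rfl hs ht]; linarith
  have hpu : ∀ t ∈ Icc a b, p t (u t).1 = v ^ 2 := fun t ht ↦ by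
    have h1 := S.eq_chartDifferential_horizontalDual hφ (hs ht) (huH t ht)
    have h2 := DFunLike.congr_fun (comp_inverse_comp_chartDifferential hφ (hs ht) (Γ t))
      (S.horizontalDual (γ t) (Γ t) : TangentSpace 𝓘(ℝ, E) (γ t))
    have h3 := S.hamiltonian_eq (γ t) (Γ t)
    rw [hen t ht] at h3
    rw [h1]
    refine Eq.trans h2 ?_
    linarith
  obtain ⟨Q, hQ, κ, hκ, hQκ⟩ := exists_euclidean_form E
  obtain ⟨K, δ, hδ, hδb, r₁, hr₁, hsub⟩ := exists_barrier_subsolution (Q := Q) (v := v) (q := q)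
    (p := p) (u := u) (H := H) hab hκ hQκ hcoord huH
    (fun t ht ↦ by
      exact (hamiltonianInChart_cotangentCoord _ hφ (hs ht) (Γ t)).trans (hen t ht)) hpu
    ((S.contDiffAt_hamiltonianInChart hφ (z := cotangentCoord φ (γ a) (Γ a)) hy₀t).of_le
      (WithTop.coe_le_coe.2 (le_top : (2 : ℕ∞) ≤ ⊤)))
  obtain ⟨r₂, hr₂, C, hC0, hC⟩ := S.exists_hamiltonianInChart_le hφ hy₀t
  obtain ⟨r₃, hr₃, hball₃⟩ := Metric.mem_nhds_iff.1 (φ.open_target.mem_nhds hy₀t)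
  have hVy : φ.symm ⁻¹' V ∈ nhds y₀ :=
    (φ.continuousAt_symm hy₀t).preimage_mem_nhds (by rwa [hy₀, φ.left_inv (hs ha)])
  obtain ⟨r₄, hr₄, hball₄⟩ := Metric.mem_nhds_iff.1 hVy
  -- a radius that fits the barrier, the bound of `H`, the chart, and the slice of `P`
  obtain ⟨r, hr, h1, h2, h3, h4⟩ : ∃ r > 0, r ≤ r₁ ∧ r ≤ r₂ ∧ r ≤ r₃ ∧ r ≤ r₄ :=
    ⟨min (min r₁ r₂) (min r₃ r₄), by positivity, by simp, by simp, by simp, by simp⟩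
  obtain ⟨η, hη, hηq⟩ := Metric.continuousWithinAt_iff.1 (hq.continuousOn a ha) (r / 4)
    (by positivity)
  obtain ⟨ε₀, hε₀, h5, h6, h7⟩ : ∃ ε₀ > 0, ε₀ ≤ δ ∧ ε₀ < η ∧ (C + 1) * (v * ε₀) < r / 4 := by
    refine ⟨min (min δ (η / 2)) (r / 8 / ((C + 1) * v)), by positivity, by simp, ?_, ?_⟩
    · have h8 := min_le_left (min δ (η / 2)) (r / 8 / ((C + 1) * v))
      have h9 := min_le_right δ (η / 2)
      linarith
    · have h8 := min_le_right (min δ (η / 2)) (r / 8 / ((C + 1) * v))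
      rw [le_div_iff₀ (by positivity)] at h8
      linarith
  refine ⟨ε₀, hε₀, by linarith, fun ε hε hεε₀ μ c d hcd hμ hμc hμd ↦ ?_⟩
  have hεb : a + ε ∈ Icc a b := ⟨by linarith, by linarith⟩
  have hnear : φ (μ d) ∈ Metric.ball y₀ (r / 4) := by
    rw [hμd]
    exact hηq hεb (by rw [Real.dist_eq, add_sub_cancel_left, abs_of_pos hε]; linarith)
  rcases S.mapsTo_or_ofReal_le_length hφ (y₀ := y₀)
    (fun y hy ↦ hball₃ (Metric.closedBall_subset_ball (by linarith) hy)) hr hC0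
    (fun y hy ↦ hC y (Metric.ball_subset_ball h2 hy)) hμ (hμd ▸ hs hεb) hnear with hmaps | hlong
  · have hsrc : MapsTo μ (Icc c d) φ.source := fun t ht ↦ (hmaps ht).1
    have hac := hμ.1.2 φ hφ c d le_rfl hcd.le le_rfl hsrc
    have hsubI : Icc a (a + ε) ⊆ Icc a b := Icc_subset_Icc_right hεb.2
    have hHc : ContinuousOn H (Metric.ball y₀ (r / 2) ×ˢ univ) := fun z hz ↦
      (S.contDiffAt_hamiltonianInChart hφ (hball₃ (Metric.ball_subset_ball (by linarith)
        hz.1))).continuousAt.continuousWithinAt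
    refine ofReal_le_lintegral_of_barrier (H := H) (U := Metric.ball y₀ (r / 2)) (q := q) (p := p)
      (u := u) (K := K) hHc (fun y _ ↦ S.hamiltonianInChart_smul φ y) hQ hv0 (fun t ht ↦ ?_)
      (hq.mono hsubI) (hp.mono hsubI)
      (fun t ht y hy ↦ hsub t ⟨ht.1, by linarith [ht.2]⟩ y
        (Metric.ball_subset_ball (by linarith) hy)) hcd hac (fun t ht ↦ (hmaps ht).2) ?_
      (by simp only [hμd, q]) (S.ae_speedLE hφ le_rfl hμ.1.1 hsrc hac)
    · exact (hu t (hsubI (Ioo_subset_Icc_self ht))).hasDerivAt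
        (Icc_mem_nhds ht.1 (ht.2.trans_le hεb.2))
    · have hcW := hmaps (left_mem_Icc.2 hcd.le)
      have hcV : μ c ∈ V := by
        have := hball₄ (Metric.ball_subset_ball (by linarith) hcW.2)
        rwa [mem_preimage, φ.left_inv hcW.1] at this
      exact (hP _ ⟨hcV, hμc⟩).le
  · by_contra! hlt
    have hlt' : ENNReal.ofReal (C + 1) * S.length μ c d ≤ ENNReal.ofReal ((C + 1) * (v * ε)) := by
      rw [ENNReal.ofReal_mul (by linarith)]
      gcongr
    have := (ENNReal.ofReal_le_ofReal_iff (by positivity)).1 (hlong.trans hlt')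
    have h8 : (C + 1) * (v * ε) ≤ (C + 1) * (v * ε₀) := by gcongr
    linarith

/-- A Hamiltonian curve whose initial covector annihilates `P` in a chart minimizes the length to
`P` for short time. -/
theorem IsHamiltonianLift.exists_isLengthMinimizing [T2Space M] (hab : a < b)
    (hΓ : S.IsHamiltonianLift γ Γ a b) {φ : OpenPartialHomeomorph M E}
    (hφ : φ ∈ IsManifold.maximalAtlas 𝓘(ℝ, E) ∞ M) (ha : γ a ∈ φ.source)
    {P V : Set M} (hγP : γ a ∈ P) (hV : V ∈ nhds (γ a))
    (hP : ∀ x ∈ V ∩ P, (cotangentCoord φ (γ a) (Γ a)).2 (φ x - φ (γ a)) = 0) :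
    ∃ ε₀ > 0, a + ε₀ ≤ b ∧ ∀ ε, 0 < ε → ε ≤ ε₀ →
      S.IsLengthMinimizing γ a (a + ε) P {γ (a + ε)} := by
  obtain ⟨η, hη, hηs⟩ := Metric.mem_nhdsWithin_iff.1
    ((hΓ.1 a (left_mem_Icc.2 hab.le)).preimage_mem_nhdsWithin (φ.open_source.mem_nhds ha))
  set b' := min b (a + η / 2) with hb'
  have hab' : a < b' := lt_min hab (by linarith)
  have hb'b : b' ≤ b := min_le_left _ _
  have hs : MapsTo γ (Icc a b') φ.source := fun t ht ↦ hηs ⟨by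
    rw [Metric.mem_ball, Real.dist_eq, abs_of_nonneg (by linarith [ht.1])]
    linarith [ht.2, min_le_right b (a + η / 2)], ht.1, ht.2.trans hb'b⟩
  have hΓ' : S.IsHamiltonianLift γ Γ a b' := by
    refine ⟨hΓ.1.mono (Icc_subset_Icc_right hb'b), fun φ hφ t ht hts ↦ ?_⟩
    obtain ⟨u, hu, hH⟩ := hΓ.2 φ hφ t (Icc_subset_Icc_right hb'b ht) hts
    exact ⟨u, hu.mono (Icc_subset_Icc_right hb'b), hH⟩
  have hlen : ∀ ε, a + ε ≤ b' → S.length γ a (a + ε)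
      = ENNReal.ofReal (Real.sqrt (2 * S.hamiltonian (γ a) (Γ a)) * ε) := fun ε hε ↦ by
    rw [hΓ'.length_eq hφ hε (hs.mono_left (Icc_subset_Icc_right hε)), add_sub_cancel_left]
  obtain ⟨ε₀, hε₀, hε₀b, hmin⟩ : ∃ ε₀ > 0, a + ε₀ ≤ b' ∧ ∀ ε, 0 < ε → ε ≤ ε₀ →
      ∀ (μ : ℝ → M) (c d : ℝ), c < d → S.IsHorizontal μ c d → μ c ∈ P → μ d = γ (a + ε) →
      ENNReal.ofReal (Real.sqrt (2 * S.hamiltonian (γ a) (Γ a)) * ε) ≤ S.length μ c d := by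
    rcases (S.hamiltonian_nonneg (γ a) (Γ a)).eq_or_lt with h0 | h0
    -- at energy zero the claimed lower bound is zero
    · refine ⟨b' - a, by linarith, by linarith, fun ε _ _ μ c d _ _ _ _ ↦ ?_⟩
      simp [← h0]
    · exact hΓ'.exists_ofReal_le_length hab' hφ hs hV hP h0
  refine ⟨ε₀, hε₀, hε₀b.trans hb'b, fun ε hε hεε₀ ↦ ?_⟩
  have hεb' : a + ε ≤ b' := by linarith
  have hhor := hΓ'.isHorizontal hεb'
  refine ⟨hhor, hγP, rfl, le_antisymm ?_ ?_⟩
  · rw [hlen ε hεb']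
    refine le_iInf₂ fun q₀ hq₀ ↦ le_iInf₂ fun q₁ hq₁ ↦ le_sInf ?_
    rintro _ ⟨μ, c, d, hcd, hμ, hμc, hμd, rfl⟩
    exact hmin ε hε hεε₀ μ c d hcd hμ (hμc ▸ hq₀) (hμd.trans hq₁)
  · refine (iInf₂_le (γ a) hγP).trans ((iInf₂_le (γ (a + ε)) (mem_singleton _)).trans (sInf_le ?_))
    exact ⟨γ, a, a + ε, by linarith, hhor, rfl, rfl, rfl⟩

end SubRiemannianStructure

end SubRiem

theorem mainTheorem5
    {E : Type*} [NormedAddCommGroup E] [NormedSpace ℝ E] [FiniteDimensional ℝ E]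
    {M : Type*} [TopologicalSpace M] [T2Space M] [ChartedSpace E M] [IsManifold 𝓘(ℝ, E) ∞ M]
    (S : SubRiem.SubRiemannianStructure E M)
    -- the submanifold `P` is the image of the smooth embedding `ι : N → M`
    {F : Type*} [NormedAddCommGroup F] [NormedSpace ℝ F] [FiniteDimensional ℝ F]
    {N : Type*} [TopologicalSpace N] [ChartedSpace F N] [IsManifold 𝓘(ℝ, F) ∞ N]
    (ι : N → M) (hι : Manifold.IsSmoothEmbedding 𝓘(ℝ, F) 𝓘(ℝ, E) ∞ ι)
    (P : Set M) (hP : P = Set.range ι)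
    (a b : ℝ) (hab : a < b) (γ : ℝ → M) (hγ : S.IsNormalGeodesic γ a b) (hγa : γ a ∈ P)
    (hΓ : ∃ Γ : ∀ t : ℝ, SubRiem.CotangentSpace E (γ t),
      S.IsHamiltonianLift γ Γ a b ∧
      -- `Γ a` vanishes on the tangent space of `P` at `γ a`
      ∀ w : TangentSpace 𝓘(ℝ, E) (γ a),
        (⟨γ a, w⟩ : TangentBundle 𝓘(ℝ, E) M) ∈ Set.range (tangentMap 𝓘(ℝ, F) 𝓘(ℝ, E) ι) →
        Γ a w = 0) :
    ∃ ε₀ : ℝ, 0 < ε₀ ∧ a + ε₀ ≤ b ∧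
      ∀ ε : ℝ, 0 < ε → ε ≤ ε₀ → S.IsLengthMinimizing γ a (a + ε) P {γ (a + ε)} := by
  subst hP
  obtain ⟨Γ, hlift, hann⟩ := hΓ
  obtain ⟨φ, hφ, ha, V, hV, hslice⟩ := SubRiem.exists_chart_annihilating hι hγa (Γ a) hann
  exact hlift.exists_isLengthMinimizing hab hφ ha hγa hV hslice
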